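/- Let $R$ be a commutative $\mathbb{C}$-algebra, let $q\in R$ be invertible, let $m,n\ge 1$ be integers and let $v_1,\dots,v_m\in R$ (for example $R=\mathbb{C}[q,q^{-1},v_1,\dots,v_m]$ with $q,v_1,\dots,v_m$ indeterminates, or $R=\mathbb{C}$ with numerical parameters). The cyclotomic Hecke algebra $H(m,1,n)$ is the associative unital $R$-algebra generated by $\tau,\sigma_1,\dots,\sigma_{n-1}$ with the defining relations $$\sigma_i\sigma_{i+1}\sigma_i=\sigma_{i+1}\sigma_i\sigma_{i+1}\ (1\le i\le n-2),\qquad \sigma_i\sigma_j=\sigma_j\sigma_i\ (|i-j|>1),$$ $$\tau\sigma_1\tau\sigma_1=\sigma_1\tau\sigma_1\tau,\qquad \tau\sigma_i=\sigma_i\tau\ (i>1),$$ $$\sigma_i^2=(q-q^{-1})\sigma_i+1\ (1\le i\le n-1),\qquad (\tau-v_1)\cdots(\tau-v_m)=0.$$ In particular each $\sigma_i$ is invertible, with $\sigma_i^{-1}=\sigma_i-(q-q^{-1})$. Let $\tilde W$ be the $R$-subalgebra of $H(m,1,n)$ generated by $\tau,\sigma_1,\dots,\sigma_{n-2}$ (for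 $n=2$ it is generated by $\tau$ alone, and for $n=1$ it is the subalgebra $R\cdot 1$ of scalars). Proposition. If $\tilde{\mathcal B}$ is a basis of $\tilde W$ as an $R$-module, then the elements $$\sigma_j^{-1}\sigma_{j-1}^{-1}\cdots\sigma_1^{-1}\,\tau^{\alpha}\,\sigma_1\sigma_2\cdots\sigma_{n-1}\,\tilde b,\qquad 0\le j\le n-1,\quad 0\le\alpha\le m-1,\quad \tilde b\in\tilde{\mathcal B},$$ form a basis of $H(m,1,n)$ as an $R$-module: the family indexed by the triples $(j,\alpha,\tilde b)$ is linearly independent over $R$ and spans $H(m,1,n)$. -/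

import Mathlib

namespace CyclotomicHecke

/-- The generators `τ, σ_1, …, σ_{n-1}` of `H(m,1,n)`; for `n = 0` there are none. -/
inductive Gen (n : ℕ) : Type
  | tau (h : 0 < n) : Gen n
  | sigma (i : ℕ) (h1 : 1 ≤ i) (h2 : i < n) : Gen n

section Free

variable (R : Type*) [CommRing R] {n : ℕ}

/-- `τ` in the free algebra. -/
abbrev freeTau (h : 0 < n) : FreeAlgebra R (Gen n) := FreeAlgebra.ι R (Gen.tau h)

/-- `σ_i` in the free algebra. -/
abbrev freeSigma (i : ℕ) (h1 : 1 ≤ i) (h2 : i < n) : FreeAlgebra R (Gen n) :=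
  FreeAlgebra.ι R (Gen.sigma i h1 h2)

end Free

/-- The defining relations of `H(m,1,n)` with parameters `q` and `v_1, …, v_m`. -/
inductive Rel {R : Type*} [CommRing R] (m n : ℕ) (q : Rˣ) (v : Fin m → R) :
    FreeAlgebra R (Gen n) → FreeAlgebra R (Gen n) → Prop
  /-- `σ_i σ_{i+1} σ_i = σ_{i+1} σ_i σ_{i+1}` for `1 ≤ i ≤ n - 2`. -/
  | braid (i : ℕ) (h1 : 1 ≤ i) (h2 : i + 1 < n) :
      Rel m n q v
        (freeSigma R i h1 (Nat.lt_of_succ_lt h2) * freeSigma R (i + 1) (Nat.le_add_left 1 i) h2 *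
          freeSigma R i h1 (Nat.lt_of_succ_lt h2))
        (freeSigma R (i + 1) (Nat.le_add_left 1 i) h2 * freeSigma R i h1 (Nat.lt_of_succ_lt h2) *
          freeSigma R (i + 1) (Nat.le_add_left 1 i) h2)
  /-- `σ_i σ_j = σ_j σ_i` for `|i - j| > 1`. -/
  | far (i j : ℕ) (hi1 : 1 ≤ i) (hi2 : i < n) (hj1 : 1 ≤ j) (hj2 : j < n)
      (hij : 1 < |(i : ℤ) - (j : ℤ)|) :
      Rel m n q v
        (freeSigma R i hi1 hi2 * freeSigma R j hj1 hj2)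
        (freeSigma R j hj1 hj2 * freeSigma R i hi1 hi2)
  /-- `τ σ_1 τ σ_1 = σ_1 τ σ_1 τ`. -/
  | tau_sigma_one (h0 : 0 < n) (h : 1 < n) :
      Rel m n q v
        (freeTau R h0 * freeSigma R 1 le_rfl h * freeTau R h0 * freeSigma R 1 le_rfl h)
        (freeSigma R 1 le_rfl h * freeTau R h0 * freeSigma R 1 le_rfl h * freeTau R h0)
  /-- `τ σ_i = σ_i τ` for `i > 1`. -/
  | tau_far (h0 : 0 < n) (i : ℕ) (h1 : 1 ≤ i) (h2 : i < n) (hi : 1 < i) :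
      Rel m n q v
        (freeTau R h0 * freeSigma R i h1 h2)
        (freeSigma R i h1 h2 * freeTau R h0)
  /-- `σ_i² = (q - q⁻¹) σ_i + 1`. -/
  | quadratic (i : ℕ) (h1 : 1 ≤ i) (h2 : i < n) :
      Rel m n q v
        (freeSigma R i h1 h2 ^ 2)
        (((q : R) - ((q⁻¹ : Rˣ) : R)) • freeSigma R i h1 h2 + 1)
  /-- `(τ - v_1) ⋯ (τ - v_m) = 0`. -/
  | cyclotomic (h0 : 0 < n) :
      Rel m n q v
        (List.ofFn fun k : Fin m => freeTau R h0 - algebraMap R (FreeAlgebra R (Gen n)) (v k)).prod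
        0

/-- The cyclotomic Hecke algebra `H(m,1,n)` over `R` with parameters `q` and `v_1, …, v_m`. -/
abbrev H {R : Type*} [CommRing R] (m n : ℕ) (q : Rˣ) (v : Fin m → R) : Type _ :=
  RingQuot (Rel m n q v)

section Elements

variable {R : Type*} [CommRing R] (m n : ℕ) (q : Rˣ) (v : Fin m → R)

/-- The generator `τ` of `H(m,1,n)`. -/
def tau (h : 0 < n) : H m n q v :=
  RingQuot.mkAlgHom R (Rel m n q v) (freeTau R h)

/-- The generator `σ_i` of `H(m,1,n)`, as an element. -/
def sigmaElt (i : ℕ) (h1 : 1 ≤ i) (h2 : i < n) : H m n q v :=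
  RingQuot.mkAlgHom R (Rel m n q v) (freeSigma R i h1 h2)

theorem sigmaElt_mul_self (i : ℕ) (h1 : 1 ≤ i) (h2 : i < n) :
    sigmaElt m n q v i h1 h2 * sigmaElt m n q v i h1 h2 =
      ((q : R) - ((q⁻¹ : Rˣ) : R)) • sigmaElt m n q v i h1 h2 + 1 := by
  have h := RingQuot.mkAlgHom_rel R (Rel.quadratic (m := m) (q := q) (v := v) i h1 h2)
  rw [map_pow, map_add, map_smul, map_one, pow_two] at h
  exact h

/-- The generator `σ_i` of `H(m,1,n)`, as a unit: by the quadratic relation its inverse is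
`σ_i - (q - q⁻¹)`. -/
def sigma (i : ℕ) (h1 : 1 ≤ i) (h2 : i < n) : (H m n q v)ˣ where
  val := sigmaElt m n q v i h1 h2
  inv := sigmaElt m n q v i h1 h2 - ((q : R) - ((q⁻¹ : Rˣ) : R)) • (1 : H m n q v)
  val_inv := by
    rw [mul_sub, sigmaElt_mul_self, mul_smul_comm, mul_one, add_sub_cancel_left]
  inv_val := by
    rw [sub_mul, sigmaElt_mul_self, smul_mul_assoc, one_mul, add_sub_cancel_left]

/-- In `H(m,1,n)` one has `(τ - v_1) ⋯ (τ - v_m) = 0`. -/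
theorem cyclotomic_tau (h : 0 < n) :
    (List.ofFn fun k : Fin m => tau m n q v h - algebraMap R (H m n q v) (v k)).prod = 0 := by
  have e := RingQuot.mkAlgHom_rel R (Rel.cyclotomic (m := m) (q := q) (v := v) h)
  rw [map_zero, map_list_prod, List.map_ofFn] at e
  rw [← e]
  congr 2
  funext k
  simp only [Function.comp_apply, map_sub, AlgHom.commutes, tau]

/-- When all the `v_k` are invertible, so is `τ`; in that case `H(m,1,n)` is a quotient of the
group algebra of the braid group of type B. -/
theorem isUnit_tau (hv : ∀ k, IsUnit (v k)) (h : 0 < n) : IsUnit (tau m n q v h) := by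
  classical
  set P : Polynomial R :=
    (List.ofFn fun k : Fin m => Polynomial.X - Polynomial.C (v k)).prod with hP
  have h1 : Polynomial.aeval (tau m n q v h) P = 0 := by
    rw [← cyclotomic_tau m n q v h, hP, map_list_prod, List.map_ofFn]
    congr 2
    funext k
    simp
  have h2 : IsUnit (P.coeff 0) := by
    rw [Polynomial.coeff_zero_eq_eval_zero, hP, List.prod_ofFn, Polynomial.eval_prod]
    refine IsUnit.prod_univ_iff.2 fun k => ?_
    simpa using (hv k).neg
  obtain ⟨u, hu⟩ := h2
  set Q : H m n q v := Polynomial.aeval (tau m n q v h) P.divX with hQ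
  have h3 : tau m n q v h * Q = -algebraMap R _ (u : R) := by
    have e := congrArg (Polynomial.aeval (tau m n q v h)) (Polynomial.X_mul_divX_add P)
    rw [h1, map_add, map_mul, Polynomial.aeval_X, Polynomial.aeval_C, ← hu] at e
    exact eq_neg_of_add_eq_zero_left e
  have h4 : Commute (tau m n q v h) Q := by
    have e := congrArg (Polynomial.aeval (tau m n q v h)) (Polynomial.X_mul (p := P.divX))
    rw [map_mul, map_mul, Polynomial.aeval_X] at e
    exact e
  have h5 : IsUnit (tau m n q v h * Q) := by
    rw [h3]
    exact (u.isUnit.map (algebraMap R (H m n q v))).neg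
  exact (h4.isUnit_mul_iff.1 h5).1

/-- The product `σ_1 σ_2 ⋯ σ_k`, for `k < n`. -/
def sigmaUp : (k : ℕ) → k < n → H m n q v
  | 0, _ => 1
  | k + 1, hk => sigmaUp k (Nat.lt_of_succ_lt hk) *
      (sigma m n q v (k + 1) (Nat.le_add_left 1 k) hk : H m n q v)

/-- The product `σ_j⁻¹ σ_{j-1}⁻¹ ⋯ σ_1⁻¹`, for `j < n`. -/
def sigmaInvDown : (j : ℕ) → j < n → H m n q v
  | 0, _ => 1
  | j + 1, hj => (((sigma m n q v (j + 1) (Nat.le_add_left 1 j) hj)⁻¹ : (H m n q v)ˣ) : H m n q v) *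
      sigmaInvDown j (Nat.lt_of_succ_lt hj)

/-- The subalgebra of `H(m,1,n)` generated by `τ, σ_1, …, σ_{n-2}`, that is, by the generators of
`H(m,1,n-1)`. For `n = 2` it is generated by `τ`, for `n = 1` by nothing. -/
def Wtilde : Subalgebra R (H m n q v) :=
  Algebra.adjoin R
    ({x | ∃ h : 0 < n - 1, x = tau m n q v (Nat.lt_of_lt_pred h).pos} ∪
      {x | ∃ (i : ℕ) (h1 : 1 ≤ i) (h2 : i < n - 1),
        x = (sigma m n q v i h1 (Nat.lt_of_lt_pred h2) : H m n q v)})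

/-- The element `σ_j⁻¹ ⋯ σ_1⁻¹ τ^α σ_1 ⋯ σ_{n-1} b`. -/
def normalForm (hn : 0 < n) (j : Fin n) (α : ℕ) (b : H m n q v) : H m n q v :=
  sigmaInvDown m n q v j j.isLt * tau m n q v hn ^ α *
    sigmaUp m n q v (n - 1) (Nat.sub_lt hn Nat.one_pos) * b

end Elements

end CyclotomicHecke

/-!
Write `n + 1` for `n`, and let `c = q - q⁻¹`. The commutation rule behind everything is that
`τ σ_1 ^ 2` commutes with `σ_1⁻¹ τ σ_1`; it lets `τ` move through `σ_1⁻¹ τ ^ α σ_1` at the cost of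
terms with a shorter word `σ_j⁻¹ ⋯ σ_1⁻¹`. Hence the span of the proposed basis is a left ideal
containing `1`.

For independence, the same commutation rules are read as the definition of operators on
`⨁_{j ≤ n} R[X]/(χ) ⊗ A`, where `χ = ∏ (X - v_k)` and `A` is any algebra in which the relations of
`H(m,1,n)` hold. They satisfy the relations of `H(m,1,n+1)`, and for `A = H(m,1,n+1)` the resulting
representation sends the element with indices `(j, α, b)`, applied to a fixed vector, to
`X ^ α ⊗ b` in position `j`. This gives independence for any independent family in the
subalgebra, without knowing a basis of `H(m,1,n)`.
-/

namespace CyclotomicHecke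

open Polynomial
open scoped TensorProduct

section HeckeTuple

variable {R A : Type*} [CommRing R] [Ring A] [Algebra R A]

/-- Elements `t` and `s 1, …, s (n - 1)` of an algebra satisfying the relations of `H(m,1,n)` other
than the cyclotomic one, with `c` in the role of `q - q⁻¹`. The other values of `s` are
arbitrary. -/
structure IsHeckeTuple (c : R) (n : ℕ) (t : A) (s : ℕ → A) : Prop where
  braid : ∀ i, 1 ≤ i → i + 1 < n → s i * s (i + 1) * s i = s (i + 1) * s i * s (i + 1)
  far : ∀ i j, 1 ≤ i → i + 1 < j → j < n → Commute (s i) (s j)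
  tau_sigma_one : 1 < n → t * s 1 * t * s 1 = s 1 * t * s 1 * t
  tau_far : ∀ i, 1 < i → i < n → Commute t (s i)
  quadratic : ∀ i, 1 ≤ i → i < n → s i * s i = c • s i + 1

/-- The word `s_k⁻¹ ⋯ s_1⁻¹`, where `s_i⁻¹` is written `s_i - c`. -/
def downWord (c : R) (s : ℕ → A) : ℕ → A
  | 0 => 1
  | k + 1 => (s (k + 1) - c • 1) * downWord c s k

/-- The word `s_1 ⋯ s_k`. -/
def upWord (s : ℕ → A) : ℕ → A
  | 0 => 1
  | k + 1 => upWord s k * s (k + 1)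

theorem downWord_succ' (c : R) (s : ℕ → A) (k : ℕ) :
    downWord c s (k + 1) = downWord c (fun i => s (i + 1)) k * (s 1 - c • 1) := by
  induction k with
  | zero => rw [downWord, downWord, downWord, one_mul, mul_one]
  | succ k ih => rw [downWord, ih, ← mul_assoc]; rfl

theorem upWord_succ' (s : ℕ → A) (k : ℕ) :
    upWord s (k + 1) = s 1 * upWord (fun i => s (i + 1)) k := by
  induction k with
  | zero => rw [upWord, upWord, upWord, one_mul, mul_one]
  | succ k ih => rw [upWord, ih, mul_assoc]; rfl

theorem downWord_mem {c : R} {s : ℕ → A} {W : Subalgebra R A} {k : ℕ}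
    (h : ∀ i, 1 ≤ i → i ≤ k → s i ∈ W) : downWord c s k ∈ W := by
  induction k with
  | zero => exact one_mem W
  | succ k ih =>
    exact mul_mem (sub_mem (h _ (by lia) le_rfl) (W.smul_mem (one_mem W) c))
      (ih fun i h₁ h₂ => h i h₁ (by lia))

theorem commute_sub_smul_one {x y : A} (h : Commute x y) (c : R) : Commute x (y - c • 1) :=
  h.sub_right ((Commute.one_right x).smul_right c)

theorem commute_downWord {c : R} {s : ℕ → A} {x : A} {k : ℕ}
    (h : ∀ i, 1 ≤ i → i ≤ k → Commute x (s i)) : Commute x (downWord c s k) := by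
  induction k with
  | zero => exact Commute.one_right x
  | succ k ih =>
    exact (commute_sub_smul_one (h _ (by lia) le_rfl) c).mul_right
      (ih fun i h₁ h₂ => h i h₁ (by lia))

theorem commute_upWord {s : ℕ → A} {x : A} {k : ℕ}
    (h : ∀ i, 1 ≤ i → i ≤ k → Commute x (s i)) : Commute x (upWord s k) := by
  induction k with
  | zero => exact Commute.one_right x
  | succ k ih => exact (ih fun i h₁ h₂ => h i h₁ (by lia)).mul_right (h _ (by lia) le_rfl)

namespace IsHeckeTuple

variable {c : R} {n : ℕ} {t : A} {s : ℕ → A}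

theorem map {B : Type*} [Ring B] [Algebra R B] (h : IsHeckeTuple c n t s) (f : A →ₐ[R] B) :
    IsHeckeTuple c n (f t) (fun i => f (s i)) where
  braid i h₁ h₂ := by simpa only [map_mul] using congrArg f (h.braid i h₁ h₂)
  far i j h₁ h₂ h₃ := (h.far i j h₁ h₂ h₃).map f
  tau_sigma_one h₁ := by simpa only [map_mul] using congrArg f (h.tau_sigma_one h₁)
  tau_far i h₁ h₂ := (h.tau_far i h₁ h₂).map f
  quadratic i h₁ h₂ := by
    simpa only [map_mul, map_add, map_smul, map_one] using congrArg f (h.quadratic i h₁ h₂)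

theorem mono {k : ℕ} (h : IsHeckeTuple c n t s) (hk : k ≤ n) : IsHeckeTuple c k t s where
  braid i h₁ h₂ := h.braid i h₁ (h₂.trans_le hk)
  far i j h₁ h₂ h₃ := h.far i j h₁ h₂ (h₃.trans_le hk)
  tau_sigma_one h₁ := h.tau_sigma_one (h₁.trans_le hk)
  tau_far i h₁ h₂ := h.tau_far i h₁ (h₂.trans_le hk)
  quadratic i h₁ h₂ := h.quadratic i h₁ (h₂.trans_le hk)

theorem mul_inv (h : IsHeckeTuple c n t s) {i : ℕ} (h₁ : 1 ≤ i) (h₂ : i < n) :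
    s i * (s i - c • 1) = 1 := by
  rw [mul_sub, h.quadratic i h₁ h₂, mul_smul_comm, mul_one, add_sub_cancel_left]

theorem inv_mul (h : IsHeckeTuple c n t s) {i : ℕ} (h₁ : 1 ≤ i) (h₂ : i < n) :
    (s i - c • 1) * s i = 1 := by
  rw [sub_mul, h.quadratic i h₁ h₂, smul_mul_assoc, one_mul, add_sub_cancel_left]

/-- This is where `τ σ_1 ^ 2` commutes with `y = σ_1⁻¹ τ σ_1`, and so with `y ^ k`. -/
theorem tau_mul_conj_pow (h : IsHeckeTuple c n t s) (hn : 1 < n) (k : ℕ) :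
    t * ((s 1 - c • 1) * t ^ k * s 1) =
      (s 1 - c • 1) * t ^ k * s 1 * t + c • (t * (s 1 * t ^ k - t ^ k * s 1)) := by
  obtain ⟨a, ha⟩ : ∃ a, a = s 1 := ⟨_, rfl⟩
  have quad : a * a = c • a + 1 := ha ▸ h.quadratic 1 le_rfl hn
  have mul_inv : a * (a - c • 1) = 1 := ha ▸ h.mul_inv le_rfl hn
  have inv_mul : (a - c • 1) * a = 1 := ha ▸ h.inv_mul le_rfl hn
  have four : t * a * t * a = a * t * a * t := ha ▸ h.tau_sigma_one hn
  rw [← ha]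
  set y := (a - c • 1) * t * a with hy
  have a_y : SemiconjBy a y t := by
    rw [SemiconjBy, hy, ← mul_assoc, ← mul_assoc, mul_inv, one_mul]
  have y_t : SemiconjBy (t * a) t y := by
    calc t * a * t = (a - c • 1) * a * (t * a * t) := by rw [inv_mul, one_mul]
      _ = (a - c • 1) * (a * t * a * t) := by simp only [mul_assoc]
      _ = y * (t * a) := by rw [← four]; simp only [hy, mul_assoc]
  have comm : Commute (t * a * a) (y ^ k) := (y_t.mul_left a_y).pow_right k
  have conj_pow : (a - c • 1) * t ^ k * a = y ^ k := by
    rw [mul_assoc, ← (a_y.pow_right k).eq, ← mul_assoc, inv_mul, one_mul]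
  have comm' : c • (t * a * y ^ k) + t * y ^ k = c • (y ^ k * (t * a)) + y ^ k * t := by
    simpa only [mul_assoc t, quad, mul_add, mul_one, mul_smul_comm, add_mul, smul_mul_assoc]
      using comm.eq
  rw [conj_pow, mul_sub, ← mul_assoc t a, (y_t.pow_right k).eq, ← (a_y.pow_right k).eq,
    ← mul_assoc t a, smul_sub, add_comm, sub_add_eq_add_sub, eq_sub_iff_add_eq, add_comm, comm']

theorem downWord_mul_upWord (h : IsHeckeTuple c n t s) {k : ℕ} (hk : k < n) :
    downWord c s k * upWord s k = 1 := by
  induction k with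
  | zero => exact one_mul 1
  | succ k ih =>
    rw [downWord, upWord, mul_assoc, ← mul_assoc (downWord c s k), ih (by lia), one_mul,
      h.inv_mul (by lia) hk]

theorem sigma_commute_downWord (h : IsHeckeTuple c n t s) {i k : ℕ} (hk : k + 1 < i)
    (hi : i < n) : Commute (s i) (downWord c s k) :=
  commute_downWord fun j h₁ _ => (h.far j i h₁ (by lia) hi).symm

theorem sigma_commute_upWord (h : IsHeckeTuple c n t s) {i k : ℕ} (hk : k + 1 < i)
    (hi : i < n) : Commute (s i) (upWord s k) :=
  commute_upWord fun j h₁ _ => (h.far j i h₁ (by lia) hi).symm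

theorem tau_commute_downWord_shift (h : IsHeckeTuple c n t s) {k : ℕ} (hk : k + 1 < n) :
    Commute t (downWord c (fun i => s (i + 1)) k) :=
  commute_downWord fun i h₁ _ => h.tau_far (i + 1) (by lia) (by lia)

theorem tau_commute_upWord_shift (h : IsHeckeTuple c n t s) {k : ℕ} (hk : k + 1 < n) :
    Commute t (upWord (fun i => s (i + 1)) k) :=
  commute_upWord fun i h₁ _ => h.tau_far (i + 1) (by lia) (by lia)

theorem sigma_mul_inv_mul_inv (h : IsHeckeTuple c n t s) {i : ℕ} (h₁ : 1 ≤ i) (h₂ : i + 1 < n) :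
    s i * (s (i + 1) - c • 1) * (s i - c • 1) =
      (s (i + 1) - c • 1) * (s i - c • 1) * s (i + 1) := by
  simp only [mul_sub, sub_mul, mul_smul_comm, smul_mul_assoc, mul_one, one_mul, h.braid i h₁ h₂,
    h.quadratic i h₁ (by lia), h.quadratic (i + 1) (by lia) h₂, smul_add, smul_sub]
  abel

theorem sigma_mul_downWord (h : IsHeckeTuple c n t s) {i k : ℕ} (h₁ : 1 ≤ i) (hik : i < k)
    (hk : k < n) : s i * downWord c s k = downWord c s k * s (i + 1) := by
  induction k with
  | zero => lia
  | succ k ih =>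
    rcases Nat.lt_succ_iff_lt_or_eq.1 hik with hlt | rfl
    · rw [downWord, ← mul_assoc, (commute_sub_smul_one (h.far i (k + 1) h₁ (by lia) hk) c).eq,
        mul_assoc, ih hlt (by lia), mul_assoc]
    · obtain ⟨i, rfl⟩ := Nat.exists_eq_add_of_le' h₁
      calc s (i + 1) * downWord c s (i + 2)
          = s (i + 1) * (s (i + 2) - c • 1) * (s (i + 1) - c • 1) * downWord c s i := by
            simp only [downWord, mul_assoc]
        _ = (s (i + 2) - c • 1) * (s (i + 1) - c • 1) * (s (i + 2) * downWord c s i) := by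
            rw [h.sigma_mul_inv_mul_inv h₁ hk, mul_assoc]
        _ = downWord c s (i + 2) * s (i + 2) := by
            rw [(h.sigma_commute_downWord (by lia) hk).eq]; simp only [downWord, mul_assoc]

theorem sigma_mul_upWord (h : IsHeckeTuple c n t s) {i k : ℕ} (h₁ : 1 ≤ i) (hik : i < k)
    (hk : k < n) : s (i + 1) * upWord s k = upWord s k * s i := by
  induction k with
  | zero => lia
  | succ k ih =>
    rcases Nat.lt_succ_iff_lt_or_eq.1 hik with hlt | rfl
    · rw [upWord, ← mul_assoc, ih hlt (by lia), mul_assoc, (h.far i (k + 1) h₁ (by lia) hk).eq,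
        mul_assoc]
    · obtain ⟨i, rfl⟩ := Nat.exists_eq_add_of_le' h₁
      calc s (i + 2) * upWord s (i + 2)
          = s (i + 2) * upWord s i * s (i + 1) * s (i + 2) := by simp only [upWord, mul_assoc]
        _ = upWord s i * (s (i + 2) * s (i + 1) * s (i + 2)) := by
            rw [(h.sigma_commute_upWord (by lia) hk).eq]; simp only [mul_assoc]
        _ = upWord s (i + 2) * s (i + 1) := by
            rw [← h.braid (i + 1) h₁ hk]; simp only [upWord, mul_assoc]

theorem downWord_shift_mul_upWord (h : IsHeckeTuple c n t s) {j k : ℕ} (hjk : j < k)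
    (hk : k < n) :
    downWord c (fun i => s (i + 1)) j * upWord s k = upWord s k * downWord c s j := by
  induction j with
  | zero => rw [downWord, downWord, one_mul, mul_one]
  | succ j ih =>
    rw [downWord, mul_assoc, ih (by lia), ← mul_assoc, sub_mul,
      h.sigma_mul_upWord (by lia) hjk hk, smul_mul_assoc, one_mul, downWord, ← mul_assoc, mul_sub,
      mul_smul_comm, mul_one]

end IsHeckeTuple

/-- The word `s_j⁻¹ ⋯ s_1⁻¹ t ^ α s_1 ⋯ s_n b`. -/
def normalWord (c : R) (n : ℕ) (t : A) (s : ℕ → A) (j α : ℕ) (b : A) : A :=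
  downWord c s j * t ^ α * upWord s n * b

/-- The span of the words `s_j⁻¹ ⋯ s_1⁻¹ t ^ α s_1 ⋯ s_n b` with `j ≤ n` and `b` in a given
subalgebra; there is no bound on the exponent `α`. -/
def normalSpan (c : R) (n : ℕ) (t : A) (s : ℕ → A) (W : Subalgebra R A) : Submodule R A :=
  Submodule.span R {x | ∃ j ≤ n, ∃ α, ∃ b ∈ W, normalWord c n t s j α b = x}

theorem normalWord_mem_normalSpan (c : R) {n : ℕ} (t : A) (s : ℕ → A) {W : Subalgebra R A} {j : ℕ}
    (hj : j ≤ n) (α : ℕ) {b : A} (hb : b ∈ W) :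
    normalWord c n t s j α b ∈ normalSpan c n t s W :=
  Submodule.subset_span ⟨j, hj, α, b, hb, rfl⟩

namespace IsHeckeTuple

variable {c : R} {n : ℕ} {t : A} {s : ℕ → A} {W : Subalgebra R A}

theorem mul_sigma_mul_tau_pow_mul_upWord (h : IsHeckeTuple c (n + 1) t s) {i : ℕ} (h₁ : 1 ≤ i)
    (h₂ : i < n) (w : A) (α : ℕ) :
    w * s (i + 1) * t ^ α * upWord s n = w * t ^ α * upWord s n * s i := by
  have tau_comm : t ^ α * s (i + 1) = s (i + 1) * t ^ α :=
    ((h.tau_far (i + 1) (by lia) (by lia)).pow_left α).eq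
  rw [mul_assoc w, ← tau_comm, ← mul_assoc w, mul_assoc _ (s (i + 1)),
    h.sigma_mul_upWord h₁ h₂ (by lia), ← mul_assoc]

theorem sigma_mul_normalWord_of_lt (h : IsHeckeTuple c (n + 1) t s) {i j : ℕ} (hji : j < i)
    (hi : i < n) (α : ℕ) (b : A) :
    s (i + 1) * normalWord c n t s j α b = normalWord c n t s j α (s i * b) := by
  simp only [normalWord, ← mul_assoc]
  rw [(h.sigma_commute_downWord (by lia) (by lia)).eq,
    h.mul_sigma_mul_tau_pow_mul_upWord (by lia) hi]

theorem sigma_mul_normalWord_of_gt (h : IsHeckeTuple c (n + 1) t s) {i j : ℕ} (h₁ : 1 ≤ i)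
    (hij : i < j) (hj : j ≤ n) (α : ℕ) (b : A) :
    s i * normalWord c n t s j α b = normalWord c n t s j α (s i * b) := by
  simp only [normalWord, ← mul_assoc]
  rw [h.sigma_mul_downWord h₁ hij (by lia), h.mul_sigma_mul_tau_pow_mul_upWord h₁ (by lia)]

theorem sigma_succ_mul_normalWord_succ (h : IsHeckeTuple c (n + 1) t s) {j : ℕ} (hj : j < n)
    (α : ℕ) (b : A) :
    s (j + 1) * normalWord c n t s (j + 1) α b = normalWord c n t s j α b := by
  simp only [normalWord, downWord, ← mul_assoc]
  rw [h.mul_inv (by lia) (by lia), one_mul]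

theorem normalWord_zero_downWord_mul (h : IsHeckeTuple c (n + 1) t s) {j : ℕ} (hj : j < n) (α : ℕ)
    (b : A) :
    normalWord c n t s 0 α (downWord c s j * b) =
      downWord c (fun i => s (i + 1)) j * t ^ α * upWord s n * b := by
  have tau_comm : t ^ α * downWord c (fun i => s (i + 1)) j =
      downWord c (fun i => s (i + 1)) j * t ^ α :=
    ((h.tau_commute_downWord_shift (by lia)).pow_left α).eq
  simp only [normalWord, downWord, one_mul, ← mul_assoc]
  rw [← tau_comm, mul_assoc _ (upWord s n), ← h.downWord_shift_mul_upWord hj n.lt_succ_self,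
    ← mul_assoc]

theorem tau_mul_normalWord_succ (h : IsHeckeTuple c (n + 1) t s) {j : ℕ} (hj : j < n) (α : ℕ)
    (b : A) :
    t * normalWord c n t s (j + 1) α b =
      normalWord c n t s (j + 1) α (t * b) +
        c • (normalWord c n t s 0 1 (downWord c s j * t ^ α * b) -
          normalWord c n t s 0 (α + 1) (downWord c s j * b)) := by
  rw [mul_assoc, h.normalWord_zero_downWord_mul hj, h.normalWord_zero_downWord_mul hj]
  obtain ⟨n, rfl⟩ := Nat.exists_eq_add_of_le' (Nat.zero_lt_of_lt hj)
  obtain ⟨w, hw⟩ : ∃ w, w = downWord c (fun i => s (i + 1)) j := ⟨_, rfl⟩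
  obtain ⟨r, hr⟩ : ∃ r, r = upWord (fun i => s (i + 1)) n := ⟨_, rfl⟩
  have tau_w : t * w = w * t := hw ▸ (h.tau_commute_downWord_shift (by lia)).eq
  have tau_r : Commute t r := hr ▸ h.tau_commute_upWord_shift (by lia)
  simp only [normalWord, downWord_succ', upWord_succ', ← hw, ← hr]
  calc t * (w * (s 1 - c • 1) * t ^ α * (s 1 * r) * b)
      = t * w * ((s 1 - c • 1) * t ^ α * s 1) * r * b := by simp only [mul_assoc]
    _ = w * (t * ((s 1 - c • 1) * t ^ α * s 1)) * r * b := by rw [tau_w]; simp only [mul_assoc]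
    _ = w * ((s 1 - c • 1) * t ^ α * s 1) * (t * r) * b +
          c • (w * t * s 1 * (t ^ α * r) * b - w * (t * t ^ α) * s 1 * r * b) := by
        rw [h.tau_mul_conj_pow (by lia)]
        simp only [mul_add, add_mul, mul_sub, sub_mul, mul_smul_comm, smul_mul_assoc, mul_assoc]
    _ = _ := by
        rw [tau_r.eq, (tau_r.pow_left α).eq, ← pow_succ']; simp only [mul_assoc, pow_one]

theorem sigma_mul_mem_normalSpan (h : IsHeckeTuple c (n + 1) t s)
    (hs : ∀ i, 1 ≤ i → i < n → s i ∈ W) {i : ℕ} (h₁ : 1 ≤ i) (h₂ : i ≤ n) {x : A}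
    (hx : x ∈ normalSpan c n t s W) : s i * x ∈ normalSpan c n t s W := by
  suffices normalSpan c n t s W ≤ (normalSpan c n t s W).comap (LinearMap.mulLeft R (s i)) from
    this hx
  refine Submodule.span_le.2 ?_
  rintro _ ⟨j, hj, α, b, hb, rfl⟩
  obtain ⟨i, rfl⟩ := Nat.exists_eq_add_of_le' h₁
  rw [SetLike.mem_coe, Submodule.mem_comap, LinearMap.mulLeft_apply]
  obtain hlt | rfl | rfl | hgt : j < i ∨ j = i ∨ j = i + 1 ∨ i + 1 < j := by lia
  · rw [h.sigma_mul_normalWord_of_lt hlt (by lia)]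
    exact normalWord_mem_normalSpan _ _ _ hj _ (mul_mem (hs i (by lia) (by lia)) hb)
  · have split : s (j + 1) * normalWord c n t s j α b =
        normalWord c n t s (j + 1) α b + c • normalWord c n t s j α b := by
      simp only [normalWord, downWord, sub_mul, smul_mul_assoc, one_mul, mul_assoc, sub_add_cancel]
    rw [split]
    exact add_mem (normalWord_mem_normalSpan _ _ _ h₂ _ hb)
      (Submodule.smul_mem _ c (normalWord_mem_normalSpan _ _ _ hj _ hb))
  · rw [h.sigma_succ_mul_normalWord_succ (by lia)]
    exact normalWord_mem_normalSpan _ _ _ (by lia) _ hb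
  · rw [h.sigma_mul_normalWord_of_gt (by lia) hgt hj]
    exact normalWord_mem_normalSpan _ _ _ hj _ (mul_mem (hs _ (by lia) (by lia)) hb)

theorem tau_mul_mem_normalSpan (h : IsHeckeTuple c (n + 1) t s) (ht : 0 < n → t ∈ W)
    (hs : ∀ i, 1 ≤ i → i < n → s i ∈ W) {x : A} (hx : x ∈ normalSpan c n t s W) :
    t * x ∈ normalSpan c n t s W := by
  suffices normalSpan c n t s W ≤ (normalSpan c n t s W).comap (LinearMap.mulLeft R t) from
    this hx
  refine Submodule.span_le.2 ?_
  rintro _ ⟨j | j, hj, α, b, hb, rfl⟩ <;>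
    rw [SetLike.mem_coe, Submodule.mem_comap, LinearMap.mulLeft_apply]
  · have shift : t * normalWord c n t s 0 α b = normalWord c n t s 0 (α + 1) b := by
      simp only [normalWord, downWord, one_mul, pow_succ', mul_assoc]
    rw [shift]
    exact normalWord_mem_normalSpan _ _ _ hj _ hb
  · have tW : t ∈ W := ht (by lia)
    have DW : downWord c s j ∈ W := downWord_mem fun i h₁ h₂ => hs i h₁ (by lia)
    rw [h.tau_mul_normalWord_succ hj]
    refine add_mem (normalWord_mem_normalSpan _ _ _ hj _ (mul_mem tW hb))
      (Submodule.smul_mem _ c (sub_mem ?_ ?_))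
    · exact normalWord_mem_normalSpan _ _ _ (Nat.zero_le n) _
        (mul_mem (mul_mem DW (pow_mem tW α)) hb)
    · exact normalWord_mem_normalSpan _ _ _ (Nat.zero_le n) _ (mul_mem DW hb)

theorem one_mem_normalSpan (h : IsHeckeTuple c (n + 1) t s) : 1 ∈ normalSpan c n t s W := by
  have one_eq : normalWord c n t s n 0 1 = 1 := by
    rw [normalWord, pow_zero, mul_one, mul_one, h.downWord_mul_upWord n.lt_succ_self]
  exact one_eq ▸ normalWord_mem_normalSpan _ _ _ le_rfl _ (one_mem W)

end IsHeckeTuple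

end HeckeTuple

section InducedModule

variable {R N : Type*} [CommRing R] [AddCommGroup N] [Module R N]

variable (R N) in
/-- The embedding of `N` at position `j ≤ n`; larger `j` are read modulo `n + 1`. -/
noncomputable def slot (n j : ℕ) : N →ₗ[R] (Fin (n + 1) →₀ N) :=
  Finsupp.lsingle (Fin.ofNat (n + 1) j)

/-- The action of `σ_i` on the induced module: the formula for `σ_i` times a normal word. -/
noncomputable def sigmaOp (c : R) (n : ℕ) (s : ℕ → Module.End R N) (i : ℕ) :
    Module.End R (Fin (n + 1) →₀ N) :=
  Finsupp.lsum R fun j : Fin (n + 1) =>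
    if (j : ℕ) + 1 < i then slot R N n j ∘ₗ s (i - 1)
    else if i = j + 1 then slot R N n i + c • slot R N n j
    else if (j : ℕ) = i then slot R N n (i - 1)
    else slot R N n j ∘ₗ s i

/-- The action of `τ` on the induced module: the formula for `τ` times a normal word, with `X` for
the multiplication by the variable and `E` for the substitution of `t` for it. -/
noncomputable def tauOp (c : R) (n : ℕ) (t X E : Module.End R N) (s : ℕ → Module.End R N) :
    Module.End R (Fin (n + 1) →₀ N) :=
  Finsupp.lsum R fun j : Fin (n + 1) =>
    if (j : ℕ) = 0 then slot R N n 0 ∘ₗ X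
    else slot R N n j ∘ₗ t + c • (slot R N n 0 ∘ₗ (X * downWord c s (j - 1) * (E - 1)))

theorem slot_val {n : ℕ} (j : Fin (n + 1)) (f : N) : slot R N n j f = Finsupp.single j f := by
  rw [slot, Finsupp.lsingle_apply, Fin.ofNat_val_eq_self]

theorem ext_slot {n : ℕ} {F G : Module.End R (Fin (n + 1) →₀ N)}
    (h : ∀ j ≤ n, ∀ f, F (slot R N n j f) = G (slot R N n j f)) : F = G := by
  refine Finsupp.lhom_ext fun j f => ?_
  simpa only [slot_val] using h j (Nat.le_of_lt_succ j.isLt) f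

theorem lsum_slot {n j : ℕ} (hj : j ≤ n) (F : Fin (n + 1) → N →ₗ[R] (Fin (n + 1) →₀ N)) (f : N) :
    Finsupp.lsum R F (slot R N n j f) = F ⟨j, Nat.lt_succ_of_le hj⟩ f := by
  have slot_eq := slot_val (R := R) (⟨j, Nat.lt_succ_of_le hj⟩ : Fin (n + 1)) f
  rw [slot_eq, Finsupp.lsum_single]

section Formulas

variable {n : ℕ} {c : R} {t X E : Module.End R N} {s : ℕ → Module.End R N}

theorem sigmaOp_slot_of_lt {i j : ℕ} (f : N) (hij : j + 1 < i) (hi : i ≤ n) :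
    sigmaOp c n s i (slot R N n j f) = slot R N n j (s (i - 1) f) := by
  rw [sigmaOp, lsum_slot (by lia), if_pos hij]; rfl

theorem sigmaOp_slot_pred {i j : ℕ} (f : N) (hij : i = j + 1) (hi : i ≤ n) :
    sigmaOp c n s i (slot R N n j f) = slot R N n i f + c • slot R N n j f := by
  rw [sigmaOp, lsum_slot (by lia), if_neg (by lia), if_pos hij]; rfl

theorem sigmaOp_slot_self {i j : ℕ} (f : N) (hij : j = i) (hi : i ≤ n) :
    sigmaOp c n s i (slot R N n j f) = slot R N n (i - 1) f := by
  rw [sigmaOp, lsum_slot (by lia), if_neg (by lia), if_neg (by lia), if_pos hij]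

theorem sigmaOp_slot_of_gt {i j : ℕ} (f : N) (hij : i < j) (hj : j ≤ n) :
    sigmaOp c n s i (slot R N n j f) = slot R N n j (s i f) := by
  rw [sigmaOp, lsum_slot hj, if_neg (by lia), if_neg (by lia), if_neg (by lia)]; rfl

theorem tauOp_slot_zero (f : N) : tauOp c n t X E s (slot R N n 0 f) = slot R N n 0 (X f) := by
  rw [tauOp, lsum_slot n.zero_le, if_pos rfl]; rfl

theorem tauOp_slot_pos {j : ℕ} (f : N) (hj : 0 < j) (hn : j ≤ n) :
    tauOp c n t X E s (slot R N n j f) =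
      slot R N n j (t f) + c • slot R N n 0 (X (downWord c s (j - 1) (E f - f))) := by
  rw [tauOp, lsum_slot hn, if_neg hj.ne']; rfl

theorem upWord_sigmaOp_slot {k : ℕ} (hk : k ≤ n) (f : N) :
    upWord (sigmaOp c n s) k (slot R N n k f) = slot R N n 0 f := by
  induction k with
  | zero => rfl
  | succ k ih =>
    rw [upWord, Module.End.mul_apply, sigmaOp_slot_self f rfl hk, Nat.add_sub_cancel, ih (by lia)]

theorem downWord_sigmaOp_slot {k : ℕ} (hk : k ≤ n) (f : N) :
    downWord c (sigmaOp c n s) k (slot R N n 0 f) = slot R N n k f := by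
  induction k with
  | zero => rfl
  | succ k ih =>
    rw [downWord, Module.End.mul_apply, ih (by lia), LinearMap.sub_apply,
      sigmaOp_slot_pred f rfl hk, LinearMap.smul_apply, Module.End.one_apply, add_sub_cancel_right]

theorem tauOp_pow_slot_zero (k : ℕ) (f : N) :
    (tauOp c n t X E s ^ k) (slot R N n 0 f) = slot R N n 0 ((X ^ k) f) := by
  induction k with
  | zero => rfl
  | succ k ih =>
    rw [pow_succ', pow_succ', Module.End.mul_apply, Module.End.mul_apply, ih, tauOp_slot_zero]

theorem aeval_tauOp_slot_zero (p : R[X]) (f : N) :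
    aeval (tauOp c n t X E s) p (slot R N n 0 f) = slot R N n 0 (aeval X p f) := by
  simp only [aeval_eq_sum_range, LinearMap.sum_apply, LinearMap.smul_apply, tauOp_pow_slot_zero,
    map_sum, map_smul]

theorem normalWord_op_slot {j : ℕ} (hj : j ≤ n) (α : ℕ) {F : Module.End R (Fin (n + 1) →₀ N)}
    {x : Fin (n + 1) →₀ N} {f : N} (hF : F x = slot R N n n f) :
    normalWord c n (tauOp c n t X E s) (sigmaOp c n s) j α F x = slot R N n j ((X ^ α) f) := by
  rw [normalWord, Module.End.mul_apply, Module.End.mul_apply, Module.End.mul_apply, hF,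
    upWord_sigmaOp_slot le_rfl, tauOp_pow_slot_zero, downWord_sigmaOp_slot hj]

end Formulas

/-- What is needed of operators `t, s_1, …, s_{n-1}, X, E` on `N` for `tauOp` and `sigmaOp` to
satisfy the relations of one more strand. The model is `R[X]/(χ) ⊗ A` with the left multiplications
by a Hecke tuple of `A` and by `X`, and `E (p ⊗ a) = 1 ⊗ p(t) a`. -/
structure IsInductionDatum (c : R) (n : ℕ) (t X E : Module.End R N) (s : ℕ → Module.End R N) :
    Prop where
  hecke : IsHeckeTuple c n t s
  X_tau : Commute X t
  X_sigma : ∀ i, 1 ≤ i → i < n → Commute X (s i)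
  E_X : SemiconjBy E X t
  E_E : E * E = E
  E_sigma_E : ∀ i, 1 ≤ i → i < n → E * s i * E = s i * E
  iSup_range : ⨆ k : ℕ, LinearMap.range (X ^ k * E) = ⊤

section SigmaRelations

variable {n : ℕ} {c : R} {t : Module.End R N} {s : ℕ → Module.End R N}

theorem sigmaOp_mul_self (h : IsHeckeTuple c n t s) {i : ℕ} (h₁ : 1 ≤ i) (h₂ : i ≤ n) :
    sigmaOp c n s i * sigmaOp c n s i = c • sigmaOp c n s i + 1 := by
  obtain ⟨i, rfl⟩ := Nat.exists_eq_add_of_le' h₁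
  have quad (k : ℕ) (hk : 1 ≤ k) (hk' : k < n) (f : N) : s k (s k f) = c • s k f + f :=
    LinearMap.congr_fun (h.quadratic k hk hk') f
  refine ext_slot fun j hj f => ?_
  simp only [Module.End.mul_apply, LinearMap.add_apply, LinearMap.smul_apply, Module.End.one_apply]
  obtain hlt | rfl | rfl | hgt : j < i ∨ j = i ∨ j = i + 1 ∨ i + 1 < j := by lia
  · simp (disch := lia) only [sigmaOp_slot_of_lt, Nat.add_sub_cancel, quad, map_add, map_smul]
  · simp (disch := lia) only [sigmaOp_slot_pred, sigmaOp_slot_self, Nat.add_sub_cancel, map_add,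
      map_smul]
    abel
  · simp (disch := lia) only [sigmaOp_slot_pred, sigmaOp_slot_self, Nat.add_sub_cancel]
    abel
  · simp (disch := lia) only [sigmaOp_slot_of_gt, quad, map_add, map_smul]

theorem sigmaOp_braid (h : IsHeckeTuple c n t s) {i : ℕ} (h₁ : 1 ≤ i) (h₂ : i < n) :
    sigmaOp c n s i * sigmaOp c n s (i + 1) * sigmaOp c n s i =
      sigmaOp c n s (i + 1) * sigmaOp c n s i * sigmaOp c n s (i + 1) := by
  obtain ⟨i, rfl⟩ := Nat.exists_eq_add_of_le' h₁
  have braid (k : ℕ) (hk : 1 ≤ k) (hk' : k + 1 < n) (f : N) :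
      s k (s (k + 1) (s k f)) = s (k + 1) (s k (s (k + 1) f)) :=
    LinearMap.congr_fun (h.braid k hk hk') f
  refine ext_slot fun j hj f => ?_
  simp only [Module.End.mul_apply]
  obtain hlt | rfl | rfl | rfl | hgt :
      j < i ∨ j = i ∨ j = i + 1 ∨ j = i + 2 ∨ i + 2 < j := by lia
  · simp (disch := lia) only [sigmaOp_slot_of_lt, Nat.add_sub_cancel, braid]
  · have quad : s (j + 1) (s (j + 1) f) = c • s (j + 1) f + f :=
      LinearMap.congr_fun (h.quadratic (j + 1) h₁ h₂) f
    simp (disch := lia) only [sigmaOp_slot_of_lt, sigmaOp_slot_of_gt, sigmaOp_slot_pred,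
      sigmaOp_slot_self, Nat.add_sub_cancel, map_add, map_smul, quad, smul_add]
    abel
  · simp (disch := lia) only [sigmaOp_slot_of_lt, sigmaOp_slot_of_gt, sigmaOp_slot_pred,
      sigmaOp_slot_self, Nat.add_sub_cancel, map_add, map_smul]
  · simp (disch := lia) only [sigmaOp_slot_of_lt, sigmaOp_slot_of_gt, sigmaOp_slot_self,
      Nat.add_sub_cancel]
  · simp (disch := lia) only [sigmaOp_slot_of_gt, braid]

theorem sigmaOp_commute (h : IsHeckeTuple c n t s) {i k : ℕ} (h₁ : 1 ≤ i) (h₂ : i + 1 < k)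
    (h₃ : k ≤ n) : Commute (sigmaOp c n s i) (sigmaOp c n s k) := by
  obtain ⟨i, rfl⟩ := Nat.exists_eq_add_of_le' h₁
  obtain ⟨k, rfl⟩ := Nat.exists_eq_add_of_le' (show 1 ≤ k by lia)
  have far (a b : ℕ) (ha : 1 ≤ a) (hab : a + 1 < b) (hb : b < n) (f : N) :
      s a (s b f) = s b (s a f) := LinearMap.congr_fun (h.far a b ha hab hb).eq f
  refine ext_slot fun j hj f => ?_
  simp only [Module.End.mul_apply]
  obtain hlt | rfl | rfl | ⟨hgt, hlt⟩ | rfl | rfl | hgt :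
      j < i ∨ j = i ∨ j = i + 1 ∨ (i + 1 < j ∧ j < k) ∨ j = k ∨ j = k + 1 ∨ k + 1 < j := by lia
  · simp (disch := lia) only [sigmaOp_slot_of_lt, Nat.add_sub_cancel, far i k]
  · simp (disch := lia) only [sigmaOp_slot_of_lt, sigmaOp_slot_pred, Nat.add_sub_cancel, map_add,
      map_smul]
  · simp (disch := lia) only [sigmaOp_slot_of_lt, sigmaOp_slot_self, Nat.add_sub_cancel]
  · simp (disch := lia) only [sigmaOp_slot_of_lt, sigmaOp_slot_of_gt, Nat.add_sub_cancel,
      far (i + 1) k]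
  · simp (disch := lia) only [sigmaOp_slot_of_gt, sigmaOp_slot_pred, map_add, map_smul]
  · simp (disch := lia) only [sigmaOp_slot_of_gt, sigmaOp_slot_self, Nat.add_sub_cancel]
  · simp (disch := lia) only [sigmaOp_slot_of_gt, far (i + 1) (k + 1)]

end SigmaRelations

namespace IsInductionDatum

variable {n : ℕ} {c : R} {t X E : Module.End R N} {s : ℕ → Module.End R N}

theorem ext (h : IsInductionDatum c n t X E s) {M : Type*} [AddCommGroup M] [Module R M]
    {F G : N →ₗ[R] M} (hFG : ∀ k : ℕ, F ∘ₗ (X ^ k * E) = G ∘ₗ (X ^ k * E)) : F = G := by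
  have le_eqLocus : ⨆ k : ℕ, LinearMap.range (X ^ k * E) ≤ LinearMap.eqLocus F G :=
    iSup_le fun k => by
      rintro _ ⟨f, rfl⟩
      exact LinearMap.congr_fun (hFG k) f
  rw [h.iSup_range, top_le_iff, LinearMap.eqLocus_eq_top] at le_eqLocus
  exact le_eqLocus

theorem E_mul_X_pow (h : IsInductionDatum c n t X E s) (k : ℕ) : E * X ^ k = t ^ k * E :=
  (h.E_X.pow_right k).eq

theorem E_tau_E (h : IsInductionDatum c n t X E s) : E * t * E = t * E := by
  rw [mul_assoc, ← h.E_X.eq, ← mul_assoc, h.E_E]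

theorem E_commute (h : IsInductionDatum c n t X E s) {y : Module.End R N} (hX : Commute X y)
    (ht : Commute t y) (hE : E * y * E = y * E) : Commute E y :=
  h.ext fun k => by
    change E * y * (X ^ k * E) = y * E * (X ^ k * E)
    calc E * y * (X ^ k * E) = E * (y * X ^ k) * E := by simp only [mul_assoc]
      _ = E * X ^ k * y * E := by rw [← (hX.pow_left k).eq, ← mul_assoc]
      _ = t ^ k * (E * y * E) := by rw [h.E_mul_X_pow]; simp only [mul_assoc]
      _ = y * (t ^ k * (E * E)) := by rw [hE, h.E_E, ← mul_assoc, (ht.pow_left k).eq, mul_assoc]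
      _ = y * (E * X ^ k * E) := by rw [h.E_mul_X_pow, mul_assoc]
      _ = y * E * (X ^ k * E) := by simp only [mul_assoc]

theorem E_commute_tau (h : IsInductionDatum c n t X E s) : Commute E t :=
  h.E_commute h.X_tau (Commute.refl t) h.E_tau_E

theorem E_commute_sigma (h : IsInductionDatum c n t X E s) {i : ℕ} (h₁ : 1 < i) (h₂ : i < n) :
    Commute E (s i) :=
  h.E_commute (h.X_sigma i h₁.le h₂) (h.hecke.tau_far i h₁ h₂) (h.E_sigma_E i h₁.le h₂)

theorem X_commute_downWord (h : IsInductionDatum c n t X E s) {k : ℕ} (hk : k < n) :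
    Commute X (downWord c s k) :=
  commute_downWord fun i h₁ _ => h.X_sigma i h₁ (by lia)

theorem E_inv_E (h : IsInductionDatum c n t X E s) {i : ℕ} (h₁ : 1 ≤ i) (h₂ : i < n) :
    E * (s i - c • 1) * E = (s i - c • 1) * E := by
  simp only [mul_sub, sub_mul, h.E_sigma_E i h₁ h₂, mul_smul_comm, smul_mul_assoc, mul_one,
    one_mul, h.E_E]

theorem E_downWord_E (h : IsInductionDatum c n t X E s) {k : ℕ} (hk : k < n) :
    E * downWord c s k * E = downWord c s k * E := by
  induction k with
  | zero => rw [downWord, mul_one, one_mul, h.E_E]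
  | succ k ih =>
    have inner : E * (downWord c s k * E) = downWord c s k * E := by rw [← mul_assoc, ih (by lia)]
    calc E * downWord c s (k + 1) * E
        = E * (s (k + 1) - c • 1) * (downWord c s k * E) := by simp only [downWord, mul_assoc]
      _ = E * (s (k + 1) - c • 1) * E * (downWord c s k * E) := by
        rw [mul_assoc _ E, inner]
      _ = downWord c s (k + 1) * E := by
        rw [h.E_inv_E (by lia) hk, mul_assoc, inner, downWord, mul_assoc]

theorem range_E_sub_one_le (h : IsInductionDatum c n t X E s) :
    LinearMap.range (E - 1) ≤ LinearMap.range (t - X) := by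
  rw [LinearMap.range_eq_map, ← h.iSup_range, Submodule.map_iSup]
  refine iSup_le fun k => ?_
  rw [← LinearMap.range_comp]
  have factor : (E - 1) * (X ^ k * E) =
      (t - X) * (∑ i ∈ Finset.range k, t ^ i * X ^ (k - 1 - i)) * E := by
    rw [h.X_tau.symm.mul_geom_sum₂, sub_mul, ← mul_assoc, h.E_mul_X_pow, mul_assoc, h.E_E, one_mul,
      sub_mul]
  refine (congrArg LinearMap.range factor).trans_le ?_
  rw [mul_assoc]
  exact LinearMap.range_comp_le_range _ _

/-- The operator form of `IsHeckeTuple.tau_mul_conj_pow`: on `X ^ k * E` the operator `E`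
substitutes `t ^ k`. -/
theorem tau_mul_conj_E (h : IsInductionDatum c n t X E s) (hn : 1 < n) :
    t * ((s 1 - c • 1) * E * s 1) =
      (s 1 - c • 1) * E * s 1 * t + c • (t * (s 1 * E - E * s 1)) :=
  h.ext fun k => by
    have E_mul {y : Module.End R N} (hX : Commute X y) (hE : E * y * E = y * E) :
        E * y * (X ^ k * E) = t ^ k * y * E := by
      rw [mul_assoc E, ← mul_assoc y, ← (hX.pow_left k).eq, ← mul_assoc E, ← mul_assoc E,
        h.E_mul_X_pow, mul_assoc (t ^ k), mul_assoc (t ^ k), hE, ← mul_assoc]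
    have X_s := h.X_sigma 1 le_rfl hn
    have E_s_E := h.E_sigma_E 1 le_rfl hn
    have E_s_t_E : E * (s 1 * t) * E = s 1 * t * E := by
      rw [← mul_assoc, mul_assoc _ t, ← h.E_tau_E, ← mul_assoc, ← mul_assoc, E_s_E, mul_assoc (s 1),
        mul_assoc (s 1), h.E_tau_E, mul_assoc]
    have E_mul_one : E * (X ^ k * E) = t ^ k * E := by
      simpa only [mul_one] using E_mul (Commute.one_right X) (by rw [mul_one, one_mul, h.E_E])
    calc t * ((s 1 - c • 1) * E * s 1) * (X ^ k * E)
        = t * ((s 1 - c • 1) * (E * s 1 * (X ^ k * E))) := by simp only [mul_assoc]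
      _ = t * ((s 1 - c • 1) * t ^ k * s 1) * E := by
        rw [E_mul X_s E_s_E]; simp only [mul_assoc]
      _ = ((s 1 - c • 1) * (t ^ k * (s 1 * t) * E)) +
          c • (t * (s 1 * (t ^ k * E) - t ^ k * s 1 * E)) := by
        rw [h.hecke.tau_mul_conj_pow hn k]
        simp only [add_mul, mul_assoc, smul_mul_assoc, sub_mul]
      _ = ((s 1 - c • 1) * E * s 1 * t + c • (t * (s 1 * E - E * s 1))) * (X ^ k * E) := by
        rw [← E_mul X_s E_s_E, ← E_mul (X_s.mul_right h.X_tau) E_s_t_E, ← E_mul_one]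
        simp only [add_mul, mul_assoc, smul_mul_assoc, sub_mul]

/-- The part in position `0` of `τ σ_1 τ σ_1 = σ_1 τ σ_1 τ`. -/
theorem X_downWord_offDiagonal (h : IsInductionDatum c n t X E s) {k : ℕ} (hk : k + 1 < n) :
    X * downWord c s (k + 1) * (E - 1) * s 1 * t +
      c • (X * E * (X * downWord c s (k + 1) * (E - 1))) =
    t * (X * downWord c s (k + 1) * (E - 1)) * s 1 := by
  obtain ⟨w, hw⟩ : ∃ w, w = downWord c (fun i => s (i + 1)) k := ⟨_, rfl⟩
  have t_w : Commute t w := hw ▸ h.hecke.tau_commute_downWord_shift hk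
  have E_w : Commute E w :=
    hw ▸ commute_downWord fun i h₁ _ => h.E_commute_sigma (by lia) (by lia)
  have E_down_E := h.E_downWord_E hk
  have inv_mul := h.hecke.inv_mul le_rfl (show 1 < n by lia)
  have conj := h.tau_mul_conj_E (show 1 < n by lia)
  have X_t := h.X_tau
  rw [downWord_succ', ← hw] at E_down_E ⊢
  set b := s 1 - c • 1 with hb
  have bracket : c • (t * b * E - t * E * b) = c • (t * (s 1 * E - E * s 1)) := by
    rw [hb]; congr 1
    simp only [mul_sub, sub_mul, mul_smul_comm, smul_mul_assoc, mul_one]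
    abel
  have through_E : E * (X * (w * b) * (E - 1)) = w * (t * b * E - t * E * b) := by
    calc E * (X * (w * b) * (E - 1))
        = E * X * (w * b) * E - E * X * w * b := by noncomm_ring
      _ = t * (E * (w * b) * E) - t * (E * w) * b := by rw [h.E_X.eq]; noncomm_ring
      _ = t * w * b * E - t * w * E * b := by rw [E_down_E, E_w.eq]; noncomm_ring
      _ = w * (t * b * E - t * E * b) := by rw [t_w.eq]; noncomm_ring
  calc X * (w * b) * (E - 1) * s 1 * t + c • (X * E * (X * (w * b) * (E - 1)))
      = X * w * (b * E * s 1 * t) - X * w * (b * s 1) * t +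
          c • (X * (E * (X * (w * b) * (E - 1)))) := by noncomm_ring
    _ = X * w * (b * E * s 1 * t + c • (t * (s 1 * E - E * s 1))) - X * w * t := by
      rw [inv_mul, through_E, ← mul_assoc X w, ← mul_smul_comm, bracket]; noncomm_ring
    _ = X * (w * t) * (b * E * s 1 - 1) := by rw [← conj]; noncomm_ring
    _ = t * X * w * (b * E * s 1 - b * s 1) := by
      rw [inv_mul, ← t_w.eq, ← mul_assoc, X_t.eq]
    _ = t * (X * (w * b) * (E - 1)) * s 1 := by noncomm_ring

theorem tauOp_commute_sigmaOp (h : IsInductionDatum c n t X E s) {i : ℕ} (h₁ : 1 < i)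
    (h₂ : i ≤ n) : Commute (tauOp c n t X E s) (sigmaOp c n s i) := by
  obtain ⟨i, rfl⟩ := Nat.exists_eq_add_of_le' h₁
  have X_s (k : ℕ) (hk : 1 ≤ k) (hk' : k < n) (f : N) : X (s k f) = s k (X f) :=
    LinearMap.congr_fun (h.X_sigma k hk hk').eq f
  have t_s (k : ℕ) (hk : 1 < k) (hk' : k < n) (f : N) : t (s k f) = s k (t f) :=
    LinearMap.congr_fun (h.hecke.tau_far k hk hk').eq f
  have E_s (k : ℕ) (hk : 1 < k) (hk' : k < n) (f : N) : E (s k f) = s k (E f) :=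
    LinearMap.congr_fun (h.E_commute_sigma hk hk').eq f
  refine ext_slot fun j hj f => ?_
  simp only [Module.End.mul_apply]
  obtain rfl | ⟨hpos, hlt⟩ | rfl | rfl | hgt :
      j = 0 ∨ (0 < j ∧ j < i + 1) ∨ j = i + 1 ∨ j = i + 2 ∨ i + 2 < j := by lia
  · simp (disch := lia) only [sigmaOp_slot_of_lt, tauOp_slot_zero, Nat.add_succ_sub_one, X_s]
  · have down (f : N) : downWord c s (j - 1) (s (i + 1) f) = s (i + 1) (downWord c s (j - 1) f) :=
      (LinearMap.congr_fun
        (h.hecke.sigma_commute_downWord (i := i + 1) (k := j - 1) (by lia) (by lia)).eq f).symm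
    simp (disch := lia) only [sigmaOp_slot_of_lt, tauOp_slot_pos, Nat.add_succ_sub_one, map_add,
      map_smul, t_s, E_s, ← map_sub, ← X_s, down]
  · simp (disch := lia) only [sigmaOp_slot_of_lt, sigmaOp_slot_pred, tauOp_slot_pos,
      Nat.add_sub_cancel, Nat.add_succ_sub_one, map_add, map_smul, downWord, Module.End.mul_apply,
      LinearMap.sub_apply, LinearMap.smul_apply, Module.End.one_apply, ← X_s]
    simp only [map_sub, map_smul]
    module
  · have cancel (f : N) : s (i + 1) ((s (i + 1) - c • 1) f) = f :=
      LinearMap.congr_fun (h.hecke.mul_inv (i := i + 1) (by lia) (by lia)) f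
    simp (disch := lia) only [sigmaOp_slot_of_lt, sigmaOp_slot_self, tauOp_slot_pos,
      Nat.add_sub_cancel, Nat.add_succ_sub_one, map_add, map_smul, downWord, Module.End.mul_apply,
      ← X_s, cancel]
  · have down (f : N) :
        s (i + 1) (downWord c s (j - 1) f) = downWord c s (j - 1) (s (i + 2) f) :=
      LinearMap.congr_fun
        (h.hecke.sigma_mul_downWord (i := i + 1) (k := j - 1) (by lia) (by lia) (by lia)) f
    simp (disch := lia) only [sigmaOp_slot_of_lt, sigmaOp_slot_of_gt, tauOp_slot_pos,
      Nat.add_succ_sub_one, map_add, map_smul, t_s, E_s, ← map_sub, ← X_s, down]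

theorem tauOp_sigmaOp_one_slot_of_le_one (h : IsInductionDatum c n t X E s) (hn : 1 ≤ n) {j : ℕ}
    (hj : j ≤ 1) (f : N) :
    tauOp c n t X E s (sigmaOp c n s 1 (tauOp c n t X E s (sigmaOp c n s 1 (slot R N n j f)))) =
      sigmaOp c n s 1
        (tauOp c n t X E s (sigmaOp c n s 1 (tauOp c n t X E s (slot R N n j f)))) := by
  have X_t (f : N) : X (t f) = t (X f) := LinearMap.congr_fun h.X_tau.eq f
  have E_X (f : N) : E (X f) = t (E f) := LinearMap.congr_fun h.E_X.eq f
  have E_E (f : N) : E (E f) = E f := LinearMap.congr_fun h.E_E f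
  obtain rfl | rfl : j = 0 ∨ j = 1 := by lia
  all_goals
    simp (disch := lia) only [sigmaOp_slot_pred, sigmaOp_slot_self, tauOp_slot_zero, tauOp_slot_pos,
      Nat.sub_self, map_add, map_sub, map_smul, downWord, Module.End.one_apply, X_t, E_X, E_E]
    module

theorem tauOp_sigmaOp_one_slot_of_one_lt (h : IsInductionDatum c n t X E s) {j : ℕ}
    (hj : 1 < j) (hn : j ≤ n) (f : N) :
    tauOp c n t X E s (sigmaOp c n s 1 (tauOp c n t X E s (sigmaOp c n s 1 (slot R N n j f)))) =
      sigmaOp c n s 1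
        (tauOp c n t X E s (sigmaOp c n s 1 (tauOp c n t X E s (slot R N n j f)))) := by
  obtain ⟨k, rfl⟩ := Nat.exists_eq_add_of_le' hj
  obtain ⟨P, hP⟩ : ∃ P, P = X * downWord c s (k + 1) * (E - 1) := ⟨_, rfl⟩
  have tau_slot (f : N) : tauOp c n t X E s (slot R N n (k + 2) f) =
      slot R N n (k + 2) (t f) + c • slot R N n 0 (P f) := by
    rw [tauOp_slot_pos f (by lia) hn, hP]; rfl
  have tau_slot_one (f : N) : tauOp c n t X E s (slot R N n 1 f) =
      slot R N n 1 (t f) + c • slot R N n 0 (X (E f) - X f) := by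
    rw [tauOp_slot_pos f Nat.one_pos (by lia), ← map_sub]; rfl
  have P_apply (f : N) : P (s 1 (t f)) = t (P (s 1 f)) - c • X (E (P f)) := by
    subst hP
    exact eq_sub_of_add_eq (LinearMap.congr_fun (h.X_downWord_offDiagonal hn) f)
  have tau_sigma : t (s 1 (t (s 1 f))) = s 1 (t (s 1 (t f))) :=
    LinearMap.congr_fun (h.hecke.tau_sigma_one (by lia)) f
  have quad : s 1 (s 1 f) = c • s 1 f + f :=
    LinearMap.congr_fun (h.hecke.quadratic 1 le_rfl (by lia)) f
  simp (disch := lia) only [tau_slot, tau_slot_one, tauOp_slot_zero, sigmaOp_slot_pred,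
    sigmaOp_slot_self, sigmaOp_slot_of_gt, map_add, map_smul, tau_sigma, P_apply, quad, map_sub]
  module

theorem isHeckeTuple_op (h : IsInductionDatum c n t X E s) :
    IsHeckeTuple c (n + 1) (tauOp c n t X E s) (sigmaOp c n s) where
  braid _ h₁ h₂ := sigmaOp_braid h.hecke h₁ (Nat.lt_of_succ_lt_succ h₂)
  far _ _ h₁ h₂ h₃ := sigmaOp_commute h.hecke h₁ h₂ (Nat.le_of_lt_succ h₃)
  tau_sigma_one hn := ext_slot fun j hj f => by
    rcases le_or_gt j 1 with hle | hgt
    · exact h.tauOp_sigmaOp_one_slot_of_le_one (by lia) hle f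
    · exact h.tauOp_sigmaOp_one_slot_of_one_lt hgt hj f
  tau_far _ h₁ h₂ := h.tauOp_commute_sigmaOp h₁ (Nat.le_of_lt_succ h₂)
  quadratic _ h₁ h₂ := sigmaOp_mul_self h.hecke h₁ (Nat.le_of_lt_succ h₂)

/-- The vectors on the left span a complement of position `0` on which `tauOp` acts as `t`. -/
theorem tauOp_slot_add (h : IsInductionDatum c n t X E s) {j : ℕ} (hj : 0 < j) (hn : j ≤ n)
    {f g : N} (hfg : E f - f = t g - X g) :
    tauOp c n t X E s (slot R N n j f + c • slot R N n 0 (X (downWord c s (j - 1) g))) =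
      slot R N n j (t f) + c • slot R N n 0 (X (downWord c s (j - 1) (t g))) := by
  have X_down (f : N) : X (downWord c s (j - 1) f) = downWord c s (j - 1) (X f) :=
    LinearMap.congr_fun (h.X_commute_downWord (by lia)).eq f
  rw [map_add, map_smul, tauOp_slot_pos _ hj hn, tauOp_slot_zero, hfg]
  simp only [map_sub, smul_sub, X_down]
  abel

theorem aeval_tauOp_slot_add (h : IsInductionDatum c n t X E s) {j : ℕ} (hj : 0 < j) (hn : j ≤ n)
    (p : R[X]) {f g : N} (hfg : E f - f = t g - X g) :
    aeval (tauOp c n t X E s) p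
        (slot R N n j f + c • slot R N n 0 (X (downWord c s (j - 1) g))) =
      slot R N n j (aeval t p f) + c • slot R N n 0 (X (downWord c s (j - 1) (aeval t p g))) := by
  have X_t (f : N) : X (t f) = t (X f) := LinearMap.congr_fun h.X_tau.eq f
  have E_t (f : N) : E (t f) = t (E f) := LinearMap.congr_fun h.E_commute_tau.eq f
  have hfg_pow (k : ℕ) : E ((t ^ k) f) - (t ^ k) f = t ((t ^ k) g) - X ((t ^ k) g) := by
    induction k with
    | zero => exact hfg
    | succ k ih => simp only [pow_succ', Module.End.mul_apply, E_t, X_t, ← map_sub, ih]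
  have pow_apply (k : ℕ) : (tauOp c n t X E s ^ k)
      (slot R N n j f + c • slot R N n 0 (X (downWord c s (j - 1) g))) =
      slot R N n j ((t ^ k) f) + c • slot R N n 0 (X (downWord c s (j - 1) ((t ^ k) g))) := by
    induction k with
    | zero => rfl
    | succ k ih =>
      rw [pow_succ', Module.End.mul_apply, ih, h.tauOp_slot_add hj hn (hfg_pow k), pow_succ']; rfl
  simp only [aeval_eq_sum_range, LinearMap.sum_apply, LinearMap.smul_apply, pow_apply, map_sum,
    map_smul, smul_add, Finset.sum_add_distrib, Finset.smul_sum, smul_comm c]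

theorem aeval_tauOp_eq_zero (h : IsInductionDatum c n t X E s) {p : R[X]}
    (hX : aeval X p = 0) (ht : 0 < n → aeval t p = 0) : aeval (tauOp c n t X E s) p = 0 := by
  refine ext_slot fun j hj f => ?_
  have zero_slot_zero (f : N) : aeval (tauOp c n t X E s) p (slot R N n 0 f) = 0 := by
    rw [aeval_tauOp_slot_zero, hX, LinearMap.zero_apply, map_zero]
  rcases Nat.eq_zero_or_pos j with rfl | hpos
  · rw [zero_slot_zero, LinearMap.zero_apply]
  · obtain ⟨g, hg⟩ := h.range_E_sub_one_le ⟨f, rfl⟩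
    have apply_add := h.aeval_tauOp_slot_add hpos hj p (f := f) (g := g) hg.symm
    simpa only [map_add, map_smul, zero_slot_zero, ht (by lia), LinearMap.zero_apply, map_zero,
      smul_zero, add_zero] using apply_add

end IsInductionDatum

end InducedModule

section EvalOp

variable {R A P : Type*} [CommRing R] [Ring A] [Algebra R A] [CommRing P] [Algebra R P]

/-- Left multiplications on `P ⊗ A` by elements of `A`. -/
noncomputable def leftMul (P : Type*) [CommRing P] [Algebra R P] :
    A →ₐ[R] Module.End R (P ⊗[R] A) :=
  (Algebra.lmul R (P ⊗[R] A)).comp Algebra.TensorProduct.includeRight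

/-- Multiplications on `P ⊗ A` by elements of `P`. -/
noncomputable def coeffMul (A : Type*) [Ring A] [Algebra R A] :
    P →ₐ[R] Module.End R (P ⊗[R] A) :=
  (Algebra.lmul R (P ⊗[R] A)).comp Algebra.TensorProduct.includeLeft

/-- The operator `p ⊗ a ↦ 1 ⊗ φ(p) a`. -/
noncomputable def evalOp (φ : P →ₐ[R] A) : Module.End R (P ⊗[R] A) :=
  Algebra.TensorProduct.includeRight.toLinearMap ∘ₗ LinearMap.mul' R A ∘ₗ
    TensorProduct.map φ.toLinearMap LinearMap.id

theorem leftMul_tmul (x a : A) (p : P) : leftMul (R := R) P x (p ⊗ₜ a) = p ⊗ₜ[R] (x * a) := by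
  simp [leftMul]

theorem coeffMul_tmul (x p : P) (a : A) : coeffMul (R := R) A x (p ⊗ₜ a) = (x * p) ⊗ₜ[R] a := by
  simp [coeffMul]

theorem evalOp_tmul (φ : P →ₐ[R] A) (p : P) (a : A) :
    evalOp φ (p ⊗ₜ a) = (1 : P) ⊗ₜ[R] (φ p * a) := rfl

theorem evalOp_one_tmul (φ : P →ₐ[R] A) (a : A) : evalOp φ (1 ⊗ₜ a) = (1 : P) ⊗ₜ[R] a := by
  rw [evalOp_tmul, map_one, one_mul]

theorem coeffMul_commute_leftMul (x : P) (a : A) :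
    Commute (coeffMul (R := R) A x) (leftMul P a) :=
  TensorProduct.ext' fun p b => by
    simp only [Module.End.mul_apply, coeffMul_tmul, leftMul_tmul]

theorem iSup_range_coeffMul_pow_mul_evalOp {x : P} (hx : Algebra.adjoin R {x} = ⊤)
    (φ : P →ₐ[R] A) : ⨆ k : ℕ, LinearMap.range (coeffMul (R := R) A x ^ k * evalOp φ) = ⊤ := by
  rw [eq_top_iff, ← TensorProduct.span_tmul_eq_top, Submodule.span_le]
  rintro _ ⟨p, a, rfl⟩
  obtain ⟨f, rfl⟩ : p ∈ (aeval (R := R) x).range := by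
    rw [← Algebra.adjoin_singleton_eq_range_aeval, hx]
    exact Algebra.mem_top
  have expand : (aeval x f) ⊗ₜ[R] a = aeval (coeffMul A x) f (evalOp φ (1 ⊗ₜ a)) := by
    rw [aeval_algHom_apply, evalOp_one_tmul, coeffMul_tmul, mul_one]
  rw [AlgHom.toRingHom_eq_coe, RingHom.coe_coe, expand, aeval_eq_sum_range, LinearMap.sum_apply]
  refine Submodule.sum_mem _ fun k _ => Submodule.smul_mem _ _ ?_
  exact Submodule.mem_iSup_of_mem k ⟨1 ⊗ₜ a, rfl⟩

theorem isInductionDatum_evalOp {c : R} {n : ℕ} {s : ℕ → A} {x : P}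
    (hx : Algebra.adjoin R {x} = ⊤) (φ : P →ₐ[R] A) (h : IsHeckeTuple c n (φ x) s) :
    IsInductionDatum c n (leftMul P (φ x)) (coeffMul A x) (evalOp φ)
      (fun i => leftMul P (s i)) where
  hecke := h.map _
  X_tau := coeffMul_commute_leftMul x _
  X_sigma _ _ _ := coeffMul_commute_leftMul x _
  E_X := TensorProduct.ext' fun p a => by
    simp only [Module.End.mul_apply, leftMul_tmul, evalOp_tmul, coeffMul_tmul, map_mul, mul_assoc]
  E_E := TensorProduct.ext' fun p a => by
    simp only [Module.End.mul_apply, evalOp_tmul, map_one, one_mul]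
  E_sigma_E _ _ _ := TensorProduct.ext' fun p a => by
    simp only [Module.End.mul_apply, evalOp_tmul, leftMul_tmul, map_one, one_mul]
  iSup_range := iSup_range_coeffMul_pow_mul_evalOp hx φ

end EvalOp

section Span

variable {R A : Type*} [CommRing R] [Ring A] [Algebra R A]

/-- The substitution `X ↦ t` on `R[X]/(f)`, where `f(t) = 0` in a possibly noncommutative
algebra. -/
noncomputable def evalRoot {f : R[X]} {t : A} (ht : aeval t f = 0) : AdjoinRoot f →ₐ[R] A :=
  Ideal.Quotient.liftₐ (Ideal.span {f}) (aeval t) fun a ha => by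
    obtain ⟨b, rfl⟩ := Ideal.mem_span_singleton'.1 ha
    rw [map_mul, ht, mul_zero]

theorem evalRoot_mk {f : R[X]} {t : A} (ht : aeval t f = 0) (p : R[X]) :
    evalRoot ht (AdjoinRoot.mk f p) = aeval t p := rfl

theorem evalRoot_root {f : R[X]} {t : A} (ht : aeval t f = 0) :
    evalRoot ht (AdjoinRoot.root f) = t := by
  rw [← AdjoinRoot.mk_X, evalRoot_mk, aeval_X]

theorem pow_mem_span_range_pow {f : R[X]} (hf : f.Monic) {t : A} (ht : aeval t f = 0) (α : ℕ) :
    t ^ α ∈ Submodule.span R (Set.range fun k : Fin f.natDegree => t ^ (k : ℕ)) := by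
  have root_pow_mem : AdjoinRoot.root f ^ α ∈ Submodule.span R
      (Set.range fun k : Fin f.natDegree => AdjoinRoot.root f ^ (k : ℕ)) := by
    have := (AdjoinRoot.powerBasis' hf).basis.mem_span (AdjoinRoot.root f ^ α)
    rwa [PowerBasis.coe_basis] at this
  have := Submodule.mem_map_of_mem (f := (evalRoot ht).toLinearMap) root_pow_mem
  rw [Submodule.map_span, ← Set.range_comp] at this
  simpa only [Function.comp_def, AlgHom.toLinearMap_apply, map_pow, evalRoot_root] using this

theorem normalSpan_le_span_range {c : R} {n m : ℕ} {t : A} {s : ℕ → A} {W : Subalgebra R A}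
    {ι : Type*} {w : ι → A}
    (ht : ∀ α : ℕ, t ^ α ∈ Submodule.span R (Set.range fun k : Fin m => t ^ (k : ℕ)))
    (hw : Subalgebra.toSubmodule W ≤ Submodule.span R (Set.range w)) :
    normalSpan c n t s W ≤ Submodule.span R
      (Set.range fun p : Fin (n + 1) × Fin m × ι => normalWord c n t s p.1 p.2.1 (w p.2.2)) := by
  refine Submodule.span_le.2 ?_
  rintro _ ⟨j, hj, α, b, hb, rfl⟩
  let word : A →ₗ[R] A →ₗ[R] A :=
    LinearMap.mul R A ∘ₗ LinearMap.mulRight R (upWord s n) ∘ₗ LinearMap.mulLeft R (downWord c s j)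
  have word_mem : word (t ^ α) b ∈ Submodule.map₂ word _ _ :=
    Submodule.apply_mem_map₂ word (ht α) (hw hb)
  rw [Submodule.map₂_span_span] at word_mem
  refine Submodule.span_mono ?_ word_mem
  rintro _ ⟨_, ⟨k, rfl⟩, _, ⟨i, rfl⟩, rfl⟩
  exact ⟨(⟨j, Nat.lt_succ_of_le hj⟩, k, i), rfl⟩

theorem toSubmodule_le_span_range_coe_basis {W : Subalgebra R A} {ι : Type*}
    (B : Module.Basis ι R W) :
    Subalgebra.toSubmodule W ≤ Submodule.span R (Set.range fun i => (B i : A)) := fun x hx => by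
  have := Submodule.mem_map_of_mem (f := W.val.toLinearMap) (B.mem_span ⟨x, hx⟩)
  rwa [Submodule.map_span, ← Set.range_comp] at this

theorem linearIndependent_coe_basis {W : Subalgebra R A} {ι : Type*} (B : Module.Basis ι R W) :
    LinearIndependent R fun i => (B i : A) :=
  B.linearIndependent.map' W.val.toLinearMap (LinearMap.ker_eq_bot.2 Subtype.val_injective)

theorem IsHeckeTuple.normalSpan_eq_top {c : R} {n : ℕ} {t : A} {s : ℕ → A} {W : Subalgebra R A}
    (h : IsHeckeTuple c (n + 1) t s) (ht : 0 < n → t ∈ W) (hs : ∀ i, 1 ≤ i → i < n → s i ∈ W)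
    (hA : Algebra.adjoin R ({t} ∪ s '' Set.Icc 1 n) = ⊤) : normalSpan c n t s W = ⊤ := by
  rw [eq_top_iff]
  rintro x -
  have hx : x ∈ Algebra.adjoin R ({t} ∪ s '' Set.Icc 1 n) := hA ▸ Algebra.mem_top
  suffices ∀ y ∈ normalSpan c n t s W, x * y ∈ normalSpan c n t s W from
    mul_one x ▸ this 1 h.one_mem_normalSpan
  induction hx using Algebra.adjoin_induction with
  | mem x hx =>
    rcases hx with rfl | ⟨i, ⟨h₁, h₂⟩, rfl⟩
    · exact fun y hy => h.tau_mul_mem_normalSpan ht hs hy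
    · exact fun y hy => h.sigma_mul_mem_normalSpan hs h₁ h₂ hy
  | algebraMap r => exact fun y hy => Algebra.smul_def r y ▸ Submodule.smul_mem _ r hy
  | add a b _ _ ha hb => exact fun y hy => add_mul a b y ▸ add_mem (ha y hy) (hb y hy)
  | mul a b _ _ ha hb => exact fun y hy => mul_assoc a b y ▸ ha _ (hb y hy)

end Span

section Presentation

variable {R : Type*} [CommRing R] {m n : ℕ} {q : Rˣ} {v : Fin m → R}

/-- The parameter `q - q⁻¹` of the quadratic relation. -/
abbrev heckeParam (q : Rˣ) : R := (q : R) - ((q⁻¹ : Rˣ) : R)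

/-- The polynomial `(X - v_1) ⋯ (X - v_m)` of the cyclotomic relation. -/
noncomputable def cyclotomicPoly (v : Fin m → R) : R[X] := ∏ k, (X - C (v k))

theorem cyclotomicPoly_monic (v : Fin m → R) : (cyclotomicPoly v).Monic :=
  monic_prod_X_sub_C v Finset.univ

theorem natDegree_cyclotomicPoly [Nontrivial R] (v : Fin m → R) :
    (cyclotomicPoly v).natDegree = m := by
  rw [cyclotomicPoly, natDegree_finsetProd_X_sub_C_eq_card, Finset.card_univ, Fintype.card_fin]

theorem aeval_cyclotomicPoly {A : Type*} [Ring A] [Algebra R A] (t : A) (v : Fin m → R) :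
    aeval t (cyclotomicPoly v) = (List.ofFn fun k => t - algebraMap R A (v k)).prod := by
  rw [cyclotomicPoly, ← List.prod_ofFn, map_list_prod, List.map_ofFn]
  simp only [Function.comp_def, map_sub, aeval_X, aeval_C]

variable (m n q v) in
/-- The generator `σ_i` of `H(m,1,n)`, with the value `0` for indices out of range. -/
noncomputable def genSigma (i : ℕ) : H m n q v :=
  if h : 1 ≤ i ∧ i < n then sigmaElt m n q v i h.1 h.2 else 0

theorem genSigma_eq {i : ℕ} (h₁ : 1 ≤ i) (h₂ : i < n) :
    genSigma m n q v i = sigmaElt m n q v i h₁ h₂ :=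
  dif_pos ⟨h₁, h₂⟩

theorem aeval_tau_cyclotomicPoly (hn : 0 < n) : aeval (tau m n q v hn) (cyclotomicPoly v) = 0 := by
  rw [aeval_cyclotomicPoly, cyclotomic_tau]

variable (m q v) in
theorem isHeckeTuple_gens (hn : 0 < n) :
    IsHeckeTuple (heckeParam q) n (tau m n q v hn) (genSigma m n q v) where
  braid i h₁ h₂ := by
    rw [genSigma_eq h₁ (Nat.lt_of_succ_lt h₂), genSigma_eq (by lia) h₂]
    simpa only [sigmaElt, map_mul] using
      RingQuot.mkAlgHom_rel R (Rel.braid (m := m) (q := q) (v := v) i h₁ h₂)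
  far i j h₁ h₂ h₃ := by
    rw [genSigma_eq h₁ (by lia), genSigma_eq (by lia) h₃]
    simpa only [sigmaElt, map_mul, Commute, SemiconjBy] using
      RingQuot.mkAlgHom_rel R (Rel.far (m := m) (q := q) (v := v) i j h₁ (by lia) (by lia) h₃
        (lt_abs.2 (Or.inr (by lia))))
  tau_sigma_one h₁ := by
    rw [genSigma_eq le_rfl h₁]
    simpa only [sigmaElt, tau, map_mul] using
      RingQuot.mkAlgHom_rel R (Rel.tau_sigma_one (m := m) (q := q) (v := v) hn h₁)
  tau_far i h₁ h₂ := by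
    rw [genSigma_eq h₁.le h₂]
    simpa only [sigmaElt, tau, map_mul, Commute, SemiconjBy] using
      RingQuot.mkAlgHom_rel R (Rel.tau_far (m := m) (q := q) (v := v) hn i h₁.le h₂ h₁)
  quadratic i h₁ h₂ := by
    rw [genSigma_eq h₁ h₂]
    exact sigmaElt_mul_self m n q v i h₁ h₂

variable (m q v) in
theorem adjoin_gens_eq_top (n : ℕ) :
    Algebra.adjoin R ({tau m (n + 1) q v n.succ_pos} ∪ genSigma m (n + 1) q v '' Set.Icc 1 n) =
      ⊤ := by
  rw [eq_top_iff]
  rintro x -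
  obtain ⟨y, rfl⟩ := RingQuot.mkAlgHom_surjective R (Rel m (n + 1) q v) x
  induction y using FreeAlgebra.induction with
  | grade0 r => rw [AlgHom.commutes]; exact Subalgebra.algebraMap_mem _ r
  | grade1 g =>
    apply Algebra.subset_adjoin
    cases g with
    | tau h => exact Or.inl rfl
    | sigma i h₁ h₂ => exact Or.inr ⟨i, ⟨h₁, Nat.le_of_lt_succ h₂⟩, genSigma_eq h₁ h₂⟩
  | mul a b ha hb => rw [map_mul]; exact mul_mem ha hb
  | add a b ha hb => rw [map_add]; exact add_mem ha hb

theorem tau_mem_Wtilde (h : 0 < n - 1) (hn : 0 < n) : tau m n q v hn ∈ Wtilde m n q v :=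
  Algebra.subset_adjoin (Or.inl ⟨h, rfl⟩)

theorem genSigma_mem_Wtilde {i : ℕ} (h₁ : 1 ≤ i) (h₂ : i < n - 1) :
    genSigma m n q v i ∈ Wtilde m n q v :=
  Algebra.subset_adjoin (Or.inr ⟨i, h₁, h₂, genSigma_eq h₁ _⟩)

section Hom

variable {A : Type*} [Ring A] [Algebra R A] {f : H m n q v →ₐ[R] A} {s : ℕ → A}

theorem map_sigmaUp (hf : ∀ i h₁ h₂, f (sigmaElt m n q v i h₁ h₂) = s i) {k : ℕ} (hk : k < n) :
    f (sigmaUp m n q v k hk) = upWord s k := by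
  induction k with
  | zero => exact map_one f
  | succ k ih => rw [sigmaUp, map_mul, ih, upWord, ← hf (k + 1) (by lia) hk]; rfl

theorem map_sigmaInvDown (hf : ∀ i h₁ h₂, f (sigmaElt m n q v i h₁ h₂) = s i) {j : ℕ}
    (hj : j < n) : f (sigmaInvDown m n q v j hj) = downWord (heckeParam q) s j := by
  induction j with
  | zero => exact map_one f
  | succ j ih =>
    have map_inv : f ((sigma m n q v (j + 1) (Nat.le_add_left 1 j) hj)⁻¹ : (H m n q v)ˣ) =
        s (j + 1) - heckeParam q • 1 := by
      rw [← hf (j + 1) (by lia) hj, ← map_one f, ← map_smul, ← map_sub]; rfl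
    rw [sigmaInvDown, map_mul, ih, map_inv, downWord]

theorem map_normalForm (hf : ∀ i h₁ h₂, f (sigmaElt m n q v i h₁ h₂) = s i) (hn : 0 < n)
    (j : Fin n) (α : ℕ) (b : H m n q v) :
    f (normalForm m n q v hn j α b) =
      normalWord (heckeParam q) (n - 1) (f (tau m n q v hn)) s j α (f b) := by
  rw [normalForm, map_mul, map_mul, map_mul, map_pow, map_sigmaInvDown hf, map_sigmaUp hf,
    normalWord]

end Hom

theorem normalForm_eq_normalWord (hn : 0 < n) (j : Fin n) (α : ℕ) (b : H m n q v) :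
    normalForm m n q v hn j α b =
      normalWord (heckeParam q) (n - 1) (tau m n q v hn) (genSigma m n q v) j α b :=
  map_normalForm (f := AlgHom.id R _) (fun _ h₁ h₂ => (genSigma_eq h₁ h₂).symm) hn j α b

theorem span_range_normalForm_eq_top (hn : 0 < n) {ι : Type*} {w : ι → H m n q v}
    (hw : Subalgebra.toSubmodule (Wtilde m n q v) ≤ Submodule.span R (Set.range w)) :
    Submodule.span R (Set.range fun p : Fin n × Fin m × ι =>
      normalForm m n q v hn p.1 p.2.1 (w p.2.2)) = ⊤ := by
  nontriviality R using Module.subsingleton R (H m n q v), Subsingleton.elim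
  obtain ⟨n, rfl⟩ := Nat.exists_eq_add_of_le' hn
  have pow_mem := pow_mem_span_range_pow (cyclotomicPoly_monic v)
    (aeval_tau_cyclotomicPoly (m := m) (q := q) hn)
  rw [natDegree_cyclotomicPoly] at pow_mem
  simp only [normalForm_eq_normalWord]
  refine eq_top_iff.2 (le_trans ?_ (normalSpan_le_span_range pow_mem hw))
  exact ((isHeckeTuple_gens m q v hn).normalSpan_eq_top (fun h => tau_mem_Wtilde h hn)
    (fun _ h₁ h₂ => genSigma_mem_Wtilde h₁ h₂) (adjoin_gens_eq_top m q v n)).ge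

/-- The values of a homomorphism from `H(m,1,n)` on the generators. -/
def genMap {A : Type*} (t : A) (s : ℕ → A) : Gen n → A
  | .tau _ => t
  | .sigma i _ _ => s i

section Lift

variable {A : Type*} [Ring A] [Algebra R A] {t : A} {s : ℕ → A}

/-- The universal property of `H(m,1,n)`. -/
noncomputable def lift (h : IsHeckeTuple (heckeParam q) n t s)
    (ht : aeval t (cyclotomicPoly v) = 0) : H m n q v →ₐ[R] A :=
  RingQuot.liftAlgHom R ⟨FreeAlgebra.lift R (genMap t s), fun x y hxy => by
    cases hxy with
    | braid i h₁ h₂ =>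
      simpa only [map_mul, FreeAlgebra.lift_ι_apply, genMap] using h.braid i h₁ h₂
    | far i j hi₁ hi₂ hj₁ hj₂ hij =>
      simp only [map_mul, FreeAlgebra.lift_ι_apply]
      obtain hlt | hlt : i + 1 < j ∨ j + 1 < i := by rw [lt_abs] at hij; lia
      · exact h.far i j hi₁ hlt hj₂
      · exact (h.far j i hj₁ hlt hi₂).symm
    | tau_sigma_one h₀ h₁ =>
      simpa only [map_mul, FreeAlgebra.lift_ι_apply, genMap] using h.tau_sigma_one h₁
    | tau_far h₀ i h₁ h₂ hi =>
      simpa only [map_mul, FreeAlgebra.lift_ι_apply, genMap] using (h.tau_far i hi h₂).eq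
    | quadratic i h₁ h₂ =>
      simpa only [pow_two, map_mul, map_add, map_smul, map_one, FreeAlgebra.lift_ι_apply, genMap]
        using h.quadratic i h₁ h₂
    | cyclotomic h₀ =>
      rw [map_zero, ← ht, aeval_cyclotomicPoly, map_list_prod, List.map_ofFn]
      simp only [Function.comp_def, map_sub, FreeAlgebra.lift_ι_apply, AlgHom.commutes, genMap]⟩

theorem lift_tau (h : IsHeckeTuple (heckeParam q) n t s) (ht : aeval t (cyclotomicPoly v) = 0)
    (hn : 0 < n) : lift h ht (tau m n q v hn) = t := by
  rw [lift, tau, RingQuot.liftAlgHom_mkAlgHom_apply, FreeAlgebra.lift_ι_apply]; rfl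

theorem lift_sigmaElt (h : IsHeckeTuple (heckeParam q) n t s)
    (ht : aeval t (cyclotomicPoly v) = 0) (i : ℕ) (h₁ : 1 ≤ i) (h₂ : i < n) :
    lift h ht (sigmaElt m n q v i h₁ h₂) = s i := by
  rw [lift, sigmaElt, RingQuot.liftAlgHom_mkAlgHom_apply, FreeAlgebra.lift_ι_apply]; rfl

end Lift

end Presentation

section InducedRep

variable {R A : Type*} [CommRing R] [Ring A] [Algebra R A] {n : ℕ} {t : A} {s : ℕ → A}

theorem isInductionDatum_adjoinRoot {c : R} {f : R[X]} (h : IsHeckeTuple c n t s)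
    (ht : aeval t f = 0) :
    IsInductionDatum c n (leftMul (AdjoinRoot f) t) (coeffMul A (AdjoinRoot.root f))
      (evalOp (evalRoot ht)) (fun i => leftMul (AdjoinRoot f) (s i)) := by
  simpa only [evalRoot_root] using
    isInductionDatum_evalOp AdjoinRoot.adjoinRoot_eq_top (evalRoot ht) (by rwa [evalRoot_root])

variable {m : ℕ} {q : Rˣ} {v : Fin m → R}

/-- The representation of `H(m,1,n+1)` on `⨁_{j ≤ n} R[X]/(χ) ⊗ A` induced from a realization in
`A` of the relations of `H(m,1,n)`, where `χ = (X - v_1) ⋯ (X - v_m)`. -/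
noncomputable def inducedRep (h : IsHeckeTuple (heckeParam q) n t s)
    (ht : aeval t (cyclotomicPoly v) = 0) :
    H m (n + 1) q v →ₐ[R]
      Module.End R (Fin (n + 1) →₀ AdjoinRoot (cyclotomicPoly v) ⊗[R] A) :=
  lift (isInductionDatum_adjoinRoot h ht).isHeckeTuple_op <|
    (isInductionDatum_adjoinRoot h ht).aeval_tauOp_eq_zero
      (by rw [aeval_algHom_apply, AdjoinRoot.aeval_eq, AdjoinRoot.mk_self, map_zero])
      (fun _ => by rw [aeval_algHom_apply, ht, map_zero])

theorem inducedRep_normalForm_apply (h : IsHeckeTuple (heckeParam q) n t s)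
    (ht : aeval t (cyclotomicPoly v) = 0) (j : Fin (n + 1)) (α : ℕ) {b : H m (n + 1) q v}
    {x : Fin (n + 1) →₀ AdjoinRoot (cyclotomicPoly v) ⊗[R] A} {a : A}
    (hb : inducedRep h ht b x = slot R _ n n (1 ⊗ₜ a)) :
    inducedRep h ht (normalForm m (n + 1) q v n.succ_pos j α b) x =
      Finsupp.single j ((AdjoinRoot.root (cyclotomicPoly v) ^ α) ⊗ₜ a) := by
  rw [inducedRep, map_normalForm (lift_sigmaElt _ _), lift_tau]
  refine (normalWord_op_slot (Nat.le_of_lt_succ j.isLt) α hb).trans ?_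
  rw [← map_pow, coeffMul_tmul, mul_one, slot_val]

theorem inducedRep_Wtilde_apply {x : H m (n + 1) q v} (hx : x ∈ Wtilde m (n + 1) q v)
    (a : H m (n + 1) q v) :
    inducedRep ((isHeckeTuple_gens m q v n.succ_pos).mono n.le_succ)
        (aeval_tau_cyclotomicPoly n.succ_pos) x (slot R _ n n (1 ⊗ₜ a)) =
      slot R _ n n (1 ⊗ₜ (x * a)) := by
  induction hx using Algebra.adjoin_induction generalizing a with
  | mem x hx =>
    obtain ⟨hn, rfl⟩ | ⟨i, h₁, h₂, rfl⟩ := hx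
    · rw [Nat.add_sub_cancel] at hn
      rw [inducedRep, lift_tau, tauOp_slot_pos _ hn le_rfl, evalOp_one_tmul, sub_self, map_zero,
        map_zero, map_zero, smul_zero, add_zero, leftMul_tmul]
    · rw [Nat.add_sub_cancel] at h₂
      change inducedRep _ _ (sigmaElt m (n + 1) q v i h₁ _) _ = _
      rw [inducedRep, lift_sigmaElt, sigmaOp_slot_of_gt _ h₂ le_rfl, leftMul_tmul, genSigma_eq h₁]
      rfl
  | algebraMap r =>
    rw [AlgHom.commutes, Module.algebraMap_end_apply, ← map_smul, ← TensorProduct.tmul_smul,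
      Algebra.smul_def]
  | add x y _ _ hx hy =>
    rw [map_add, LinearMap.add_apply, hx, hy, ← map_add, ← TensorProduct.tmul_add, add_mul]
  | mul x y _ _ hx hy => rw [map_mul, Module.End.mul_apply, hy, hx, mul_assoc]

theorem linearIndependent_root_pow {f : R[X]} (hf : f.Monic) :
    LinearIndependent R fun k : Fin f.natDegree => AdjoinRoot.root f ^ (k : ℕ) := by
  have := (AdjoinRoot.powerBasis' hf).basis.linearIndependent
  rwa [PowerBasis.coe_basis] at this

theorem linearIndependent_normalForm (hn : 0 < n) {ι : Type*} {w : ι → H m n q v}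
    (hW : ∀ i, w i ∈ Wtilde m n q v) (hw : LinearIndependent R w) :
    LinearIndependent R fun p : Fin n × Fin m × ι =>
      normalForm m n q v hn p.1 p.2.1 (w p.2.2) := by
  nontriviality R using linearIndependent_of_subsingleton
  obtain ⟨n, rfl⟩ := Nat.exists_eq_add_of_le' hn
  have root_pow := linearIndependent_root_pow (cyclotomicPoly_monic v)
  rw [natDegree_cyclotomicPoly] at root_pow
  have := (cyclotomicPoly_monic v).free_adjoinRoot
  have single_tmul := (Finsupp.linearIndependent_single (R := R) (ι := Fin (n + 1)) _
    fun _ => root_pow.tmul_of_flat_left hw).comp _ (Equiv.sigmaEquivProd _ _).symm.injective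
  let rep := inducedRep ((isHeckeTuple_gens m q v hn).mono n.le_succ) (aeval_tau_cyclotomicPoly hn)
  refine .of_comp (LinearMap.applyₗ (slot R _ n n (1 ⊗ₜ 1)) ∘ₗ rep.toLinearMap) ?_
  convert single_tmul using 1
  funext ⟨j, k, i⟩
  refine inducedRep_normalForm_apply (a := w i) _ _ j k ?_
  rw [inducedRep_Wtilde_apply (hW i), mul_one]

end InducedRep

end CyclotomicHecke

theorem mainTheorem3_general {R : Type*} [CommRing R] (m n : ℕ) (hn : 0 < n) (q : Rˣ)
    (v : Fin m → R) {ι : Type*} (B : Module.Basis ι R (CyclotomicHecke.Wtilde m n q v)) :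
    LinearIndependent R (fun p : Fin n × Fin m × ι =>
        CyclotomicHecke.normalForm m n q v hn p.1 (p.2.1 : ℕ)
          (B p.2.2 : CyclotomicHecke.H m n q v)) ∧
      Submodule.span R (Set.range (fun p : Fin n × Fin m × ι =>
        CyclotomicHecke.normalForm m n q v hn p.1 (p.2.1 : ℕ)
          (B p.2.2 : CyclotomicHecke.H m n q v))) = ⊤ := by
  let w (i : ι) : CyclotomicHecke.H m n q v := B i
  have w_mem (i : ι) : w i ∈ CyclotomicHecke.Wtilde m n q v := (B i).2
  have w_indep : LinearIndependent R w := CyclotomicHecke.linearIndependent_coe_basis B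
  have Wtilde_le_span : Subalgebra.toSubmodule (CyclotomicHecke.Wtilde m n q v) ≤
      Submodule.span R (Set.range w) := CyclotomicHecke.toSubmodule_le_span_range_coe_basis B
  exact ⟨CyclotomicHecke.linearIndependent_normalForm (w := w) hn w_mem w_indep,
    CyclotomicHecke.span_range_normalForm_eq_top (w := w) hn Wtilde_le_span⟩

theorem mainTheorem3 {R : Type*} [CommRing R] [Algebra ℂ R] (m n : ℕ) (hm : 0 < m) (hn : 0 < n)
    (q : Rˣ) (v : Fin m → R) {ι : Type*}
    (B : Module.Basis ι R (CyclotomicHecke.Wtilde m n q v)) :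
    LinearIndependent R (fun p : Fin n × Fin m × ι =>
        CyclotomicHecke.normalForm m n q v hn p.1 (p.2.1 : ℕ)
          (B p.2.2 : CyclotomicHecke.H m n q v)) ∧
      Submodule.span R (Set.range (fun p : Fin n × Fin m × ι =>
        CyclotomicHecke.normalForm m n q v hn p.1 (p.2.1 : ℕ)
          (B p.2.2 : CyclotomicHecke.H m n q v))) = ⊤ := by
  exact mainTheorem3_general m n hn q v B
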